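/- Let $G=(V,E)$ be a finite simple graph and consider a Gaussian graphical model on $G$ with density $p(x)\propto\exp\{-\tfrac12x^TJx+h^Tx\}$, where $J$ is symmetric positive definite with unit diagonal and $J_{ij}=0$ for distinct non-adjacent $i,j$. Put $R=I-J$ and $P=J^{-1}$. The weight of a walk $w=(w_0,\dots,w_l)$ in $G$ is $\prod_{s=1}^{l}R_{w_{s-1}w_s}$ (it is $1$ if $l=0$). LBP with parameters $(J,h)$ starts from zero messages and iterates, for each edge and both of its directions, $$\Delta J^{(t+1)}_{i\to j}=-J_{ji}\big(\hat J^{(t)}_{i\setminus j}\big)^{-1}J_{ij},\qquad \Delta h^{(t+1)}_{i\to j}=-J_{ji}\big(\hat J^{(t)}_{i\setminus j}\big)^{-1}\hat h^{(t)}_{i\setminus j},$$ where $\hat J^{(t)}_{i\setminus j}=J_{ii}+\sum_{l\in N(i)\setminus j}\Delta J^{(t)}_{l\to i}$ and $\hat h^{(t)}_{i\setminus j}=h_i+\sum_{l\in N(i)\setminus j}\Delta h^{(t)}_{l\to i}$. It converges if it never divides by zero, all messages converge, and the numbers $\hat J_i=J_{ii}+\sum_{l\in N(i)}\Delta J_{l\to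 i}$ formed with the limits are nonzero. It then computes the variances $P^{\mathrm{LBP}}_{ii}=\hat J_i^{-1}$ and the means $\hat J_i^{-1}\big(h_i+\sum_{l\in N(i)}\Delta h_{l\to i}\big)$. For $A\subseteq V$ let $T=V\setminus A$. (Approximate) feedback message passing, FMP, with feedback nodes $A$ consists of the following steps. (1) Run LBP on the subgraph induced on $T$ with $J_T$ and each of the potential vectors $h_T$ and $h^p=J_{T,p}$, $p\in A$; this gives partial variances $P^T_{ii}$, partial means $\mu^T$, and feedback gains $g^p$ (the means for $h^p$). (2) Form $(\hat J_A)_{pq}=J_{pq}-\sum_{j\in N(p)\cap T}J_{pj}g^q_j$ and $(\hat h_A)_p=h_p-\sum_{j\in N(p)\cap T}J_{pj}\mu^T_j$, and set $P_A=\hat J_A^{-1}$, $\mu_A=P_A\hat h_A$. (3) Run LBP on $T$ again with the potentials $\tilde h_i=h_i-\sum_{j\in N(i)\cap A}J_{ij}(\mu_A)_j$. The computed variances are $P^{A}_{ii}=(P_A)_{ii}$ for $i\in A$ and $P^{A}_{ii}=P^T_{ii}+\sum_{p,q\in A}g^p_i(P_A)_{pq}g^q_i$ for $i\in T$. FMP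 converges if all these LBP runs converge and $\hat J_A$ is invertible. Let $\mathcal F\subseteq V$ be a feedback vertex set (its removal leaves a cycle-free graph), and let $\tilde{\mathcal F}_1\subseteq\dots\subseteq\tilde{\mathcal F}_k\subseteq\mathcal F$ be nested subsets, for example pseudo-feedback vertex sets (subsets of a feedback vertex set that do not break all cycles). 1. If the model is attractive, i.e. $R_{ij}\ge 0$ for all $i,j$, then LBP on $G$ and FMP with each $\tilde{\mathcal F}_j$ and with $\mathcal F$ converge, and for every node $i$ $$P^{\mathrm{LBP}}_{ii}\le P^{\tilde{\mathcal F}_1}_{ii}\le\dots\le P^{\tilde{\mathcal F}_k}_{ii}\le P^{\mathcal F}_{ii}=P_{ii}.$$ 2. Call a walk from $i$ to $i$ backtracking if it can be reduced to the single node $i$ by successively replacing subwalks $a,b,a$ by $a$. Let $W^{\mathrm{LBP}}_i$ be the set of backtracking walks from $i$ to $i$, and let $W^{A}_i$ be the set of those walks from $i$ to $i$ that visit $A$ or are backtracking and stay in $V\setminus A$. If the model is walk-summable, i.e. for all $i,j$ the sum of the weights of all walks from $i$ to $j$ converges for any order of the summands, then LBP on $G$ and FMP with each $\tilde{\mathcal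 F}_j$ and with $\mathcal F$ converge; the variances $P^{\mathrm{LBP}}_{ii}$, $P^{\tilde{\mathcal F}_j}_{ii}$, $P^{\mathcal F}_{ii}$ are the (unconditionally convergent) sums of the weights of the walks in $W^{\mathrm{LBP}}_i$, $W^{\tilde{\mathcal F}_j}_i$, $W^{\mathcal F}_i$ respectively, so that these are the sets of captured walks; and for every node $i$ $$W^{\mathrm{LBP}}_i\subseteq W^{\tilde{\mathcal F}_1}_i\subseteq\dots\subseteq W^{\tilde{\mathcal F}_k}_i\subseteq W^{\mathcal F}_i.$$ -/

import Mathlib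

open Filter Topology

namespace GaussianFMP

noncomputable section

/-! ### Gaussian graphical models in normalized information form -/

/-- `J` is the information matrix of a non-degenerate Gaussian vector that is Markov on `G`,
normalized to have unit diagonal. -/
structure IsNormalizedModel {V : Type*} (G : SimpleGraph V) (J : Matrix V V ℝ) : Prop where
  posDef : J.PosDef
  diag : ∀ i, J i i = 1
  markov : ∀ i j, i ≠ j → ¬ G.Adj i j → J i j = 0

/-- The edge-weight matrix `R = I - J`. -/
def edgeWeight {V : Type*} [DecidableEq V] (J : Matrix V V ℝ) : Matrix V V ℝ := 1 - J

/-- Attractive models: all entries of `R` are nonnegative. -/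
def IsAttractive {V : Type*} [DecidableEq V] (J : Matrix V V ℝ) : Prop :=
  ∀ i j, 0 ≤ edgeWeight J i j

/-! ### Walks -/

/-- The weight of a walk: the product of the edge weights along its steps
(one for a walk of length zero). -/
def walkWeight {V : Type*} {G : SimpleGraph V} (R : Matrix V V ℝ) {i j : V}
    (w : G.Walk i j) : ℝ :=
  (w.darts.map fun d => R d.fst d.snd).prod

/-- For all `i`, `j` the sum over all walks from `i` to `j` converges for any order of the
summands. -/
def WalkSummable {V : Type*} [DecidableEq V] (G : SimpleGraph V) (J : Matrix V V ℝ) : Prop :=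
  ∀ i j, Summable fun w : G.Walk i j => walkWeight (edgeWeight J) w

/-- One reduction: a subwalk `a, b, a` is replaced by the single node `a`. -/
inductive WalkReduces {V : Type*} {G : SimpleGraph V} {u v : V} :
    G.Walk u v → G.Walk u v → Prop
  | step {a b : V} (p : G.Walk u a) (hab : G.Adj a b) (q : G.Walk a v) :
      WalkReduces (p.append (SimpleGraph.Walk.cons hab (SimpleGraph.Walk.cons hab.symm q)))
        (p.append q)

/-- A backtracking walk: a self-return walk which can be reduced to a single node. -/
def IsBacktracking {V : Type*} {G : SimpleGraph V} {i : V} (w : G.Walk i i) : Prop :=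
  Relation.ReflTransGen WalkReduces w SimpleGraph.Walk.nil

/-! ### Loopy belief propagation (initialized with zero messages) -/

section LBP

variable {V : Type*} [Fintype V] [DecidableEq V] (G : SimpleGraph V) [DecidableRel G.Adj]

/-- `a i + ∑_{k ∈ N(i) \ j} m k i`, where `m k i` is the message from `k` to `i`. -/
def cavity (a : V → ℝ) (m : V → V → ℝ) (i j : V) : ℝ :=
  a i + ∑ k ∈ (G.neighborFinset i).erase j, m k i

/-- `a i + ∑_{k ∈ N(i)} m k i`. -/
def marginal (a : V → ℝ) (m : V → V → ℝ) (i : V) : ℝ :=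
  a i + ∑ k ∈ G.neighborFinset i, m k i

/-- The messages `ΔJ_{i → j}` after `t` iterations. -/
def messageJ (J : Matrix V V ℝ) : ℕ → V → V → ℝ
  | 0 => fun _ _ => 0
  | t + 1 => fun i j => -(J j i * (cavity G J.diag (messageJ J t) i j)⁻¹ * J i j)

/-- The messages `Δh_{i → j}` after `t` iterations. -/
def messageH (J : Matrix V V ℝ) (h : V → ℝ) : ℕ → V → V → ℝ
  | 0 => fun _ _ => 0
  | t + 1 => fun i j => -(J j i * (cavity G J.diag (messageJ G J t) i j)⁻¹ *
      cavity G h (messageH J h t) i j)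

/-- The fixed-point messages `ΔJ_{i → j}` (meaningful if the messages converge). -/
def fixedJ (J : Matrix V V ℝ) (i j : V) : ℝ :=
  limUnder atTop fun t => messageJ G J t i j

/-- The fixed-point messages `Δh_{i → j}` (meaningful if the messages converge). -/
def fixedH (J : Matrix V V ℝ) (h : V → ℝ) (i j : V) : ℝ :=
  limUnder atTop fun t => messageH G J h t i j

/-- LBP with parameters `(J, h)` is well defined (it never divides by zero) and all messages
along edges converge. -/
structure LBPConverges (J : Matrix V V ℝ) (h : V → ℝ) : Prop where
  cavity_ne_zero : ∀ t i j, G.Adj i j → cavity G J.diag (messageJ G J t) i j ≠ 0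
  tendsto_J : ∀ i j, G.Adj i j → ∃ a, Tendsto (fun t => messageJ G J t i j) atTop (𝓝 a)
  tendsto_H : ∀ i j, G.Adj i j → ∃ a, Tendsto (fun t => messageH G J h t i j) atTop (𝓝 a)
  marginal_ne_zero : ∀ i, marginal G J.diag (fixedJ G J) i ≠ 0

/-- The variances computed by LBP. -/
def lbpVar (J : Matrix V V ℝ) (i : V) : ℝ :=
  (marginal G J.diag (fixedJ G J) i)⁻¹

/-- The means computed by LBP. -/
def lbpMean (J : Matrix V V ℝ) (h : V → ℝ) (i : V) : ℝ :=
  (marginal G J.diag (fixedJ G J) i)⁻¹ * marginal G h (fixedH G J h) i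

end LBP

/-! ### (Approximate) feedback message passing -/

section FMP

variable {V : Type*} [Fintype V] [DecidableEq V] (G : SimpleGraph V) [DecidableRel G.Adj]

/-- The nodes that remain after removal of `F`. -/
abbrev Rest (F : Finset V) : Type _ := {i : V // i ∉ F}

/-- The subgraph that remains after removal of `F` and of the incident edges. -/
abbrev restGraph (F : Finset V) : SimpleGraph (Rest F) := G.comap Subtype.val

/-- Feedback vertex sets: removing `F` leaves a cycle-free graph. -/
def IsFVS {V : Type*} (G : SimpleGraph V) (F : Finset V) : Prop :=
  (restGraph G F).IsAcyclic

/-- The information matrix restricted to the remaining nodes. -/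
abbrev restJ (J : Matrix V V ℝ) (F : Finset V) : Matrix (Rest F) (Rest F) ℝ :=
  J.submatrix Subtype.val Subtype.val

/-- The feedback gain `g^p`: the means that LBP on the remaining graph computes with the
potential vector `h^p = J_{T,p}`. -/
def gain (J : Matrix V V ℝ) (F : Finset V) (p : {p : V // p ∈ F}) : Rest F → ℝ :=
  lbpMean (restGraph G F) (restJ J F) fun i => J i p

/-- The partial means on the remaining graph. -/
def partialMean (J : Matrix V V ℝ) (h : V → ℝ) (F : Finset V) : Rest F → ℝ :=
  lbpMean (restGraph G F) (restJ J F) fun i => h i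

/-- The information matrix of the small inference problem on the feedback nodes. -/
def hatJ (J : Matrix V V ℝ) (F : Finset V) : Matrix {p : V // p ∈ F} {p : V // p ∈ F} ℝ :=
  fun p q => J p q - ∑ j : Rest F, if G.Adj p j then J p j * gain G J F q j else 0

/-- The potential vector of the small inference problem on the feedback nodes. -/
def hatH (J : Matrix V V ℝ) (h : V → ℝ) (F : Finset V) : {p : V // p ∈ F} → ℝ :=
  fun p => h p - ∑ j : Rest F, if G.Adj p j then J p j * partialMean G J h F j else 0

/-- The covariance matrix computed for the feedback nodes. -/
def feedbackCov (J : Matrix V V ℝ) (F : Finset V) :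
    Matrix {p : V // p ∈ F} {p : V // p ∈ F} ℝ :=
  (hatJ G J F)⁻¹

/-- The means computed for the feedback nodes. -/
def feedbackMean (J : Matrix V V ℝ) (h : V → ℝ) (F : Finset V) : {p : V // p ∈ F} → ℝ :=
  (feedbackCov G J F).mulVec (hatH G J h F)

/-- The revised potential vector on the remaining nodes, for the second round of LBP. -/
def revisedH (J : Matrix V V ℝ) (h : V → ℝ) (F : Finset V) : Rest F → ℝ :=
  fun i => h i - ∑ j : {p : V // p ∈ F}, if G.Adj i j then J i j * feedbackMean G J h F j else 0

/-- Convergence of (approximate) FMP with feedback nodes `F`: every run of LBP in it converges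
and the linear system on the feedback nodes is nonsingular. -/
structure FMPConverges (J : Matrix V V ℝ) (h : V → ℝ) (F : Finset V) : Prop where
  first : LBPConverges (restGraph G F) (restJ J F) fun i => h i
  gains : ∀ p ∈ F, LBPConverges (restGraph G F) (restJ J F) fun i => J i p
  nonsingular : IsUnit (hatJ G J F).det
  second : LBPConverges (restGraph G F) (restJ J F) (revisedH G J h F)

/-- The variances computed by (approximate) FMP with feedback nodes `F`. If `F` is a feedback
vertex set, LBP on the remaining forest is ordinary BP and this is exact FMP. -/
def fmpVar (J : Matrix V V ℝ) (F : Finset V) (i : V) : ℝ :=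
  if hi : i ∈ F then feedbackCov G J F ⟨i, hi⟩ ⟨i, hi⟩
  else lbpVar (restGraph G F) (restJ J F) ⟨i, hi⟩ +
    ∑ p : {p : V // p ∈ F}, ∑ q : {p : V // p ∈ F},
      gain G J F p ⟨i, hi⟩ * feedbackCov G J F p q * gain G J F q ⟨i, hi⟩

end FMP

/-! ### Captured walks -/

/-- The walks captured by LBP for the variance of `i`: the backtracking walks of `i`. -/
def lbpWalks {V : Type*} (G : SimpleGraph V) (i : V) : Set (G.Walk i i) :=
  {w | IsBacktracking w}

/-- The walks captured by (approximate) FMP for the variance of `i`: the self-return walks that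
visit `F` and the backtracking walks within the remaining graph. -/
def fmpWalks {V : Type*} (G : SimpleGraph V) (F : Finset V) (i : V) : Set (G.Walk i i) :=
  {w | (∃ v ∈ w.support, v ∈ F) ∨ (IsBacktracking w ∧ ∀ v ∈ w.support, v ∉ F)}

end

end GaussianFMP

open GaussianFMP

namespace GaussianFMP

set_option linter.unusedSectionVars false

/-! ### Convergence of the LBP messages. -/

section Convergence

variable {V : Type*} [Fintype V] [DecidableEq V] {G : SimpleGraph V} [DecidableRel G.Adj]
  {J : Matrix V V ℝ}

/-! Everything is reduced to walk sums. Absolute summability gives, for each positive `u`, a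
positive `z` with `(I - |R|) z = u`: after rescaling by `z`, `J` is strictly diagonally dominant.
This keeps all cavities positive and makes the `ΔJ` messages decrease to a limit. The increments of
`Δh` are dominated by those of a nonnegative comparison recursion, which `z` bounds, so `Δh`
converges too. At the limit the fixed-point equations force the means to solve `J x = h`
(`mulVec_lbpMean`).

Backtracking walks are parsed uniquely as binary trees (`treeEquivLbpWalks`), and tree sums obey the
same nonlinear recursion as the reciprocal cavities. Truncation by height bounds the tree sums by
LBP, induction on the iterations gives the converse, and so `lbpVar` is the sum over backtracking
walks (`hasSum_lbpWalks`).

In FMP the gains are exact, hence `hatJ` is a Schur complement and its inverse is the true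
covariance on `F`. The only error in a variance is that of LBP on the remaining graph: the sum over
all walks loses the walks that avoid `F` and regains the backtracking ones among them
(`hasSum_fmpVar`). If a forest remains, all its closed walks backtrack, so nothing is lost.

Attractive models have `J⁻¹ ≥ 0`, which bounds the truncated walk sums and yields walk-summability.
Their weights are nonnegative, so nested walk sets give ordered variances. -/

theorem IsNormalizedModel.symm (hJ : IsNormalizedModel G J) (i j : V) : J i j = J j i := by
  have := hJ.posDef.isHermitian.apply j i
  simpa using this

theorem sum_neighborFinset_eq_add_sum_erase (f : V → ℝ) {i j : V} (hij : G.Adj i j) :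
    ∑ k ∈ G.neighborFinset i, f k = f j + ∑ k ∈ (G.neighborFinset i).erase j, f k :=
  (Finset.add_sum_erase _ _ (by simpa using hij)).symm

theorem marginal_eq_cavity_add (a : V → ℝ) (m : V → V → ℝ) {i j : V} (hij : G.Adj i j) :
    marginal G a m i = cavity G a m i j + m j i := by
  rw [marginal, cavity, sum_neighborFinset_eq_add_sum_erase (fun k => m k i) hij]
  ring

/-- Strict dominance in row `i` absorbs the worst case of all incoming messages. The message from
`j` is left out, so its share `|J i j| * z j` remains as a margin. -/
theorem IsNormalizedModel.cavity_lower_bound (hJ : IsNormalizedModel G J) {z : V → ℝ}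
    {m : V → V → ℝ} (hz : ∀ i, ∑ k ∈ G.neighborFinset i, |J i k| * z k < z i)
    (hm : ∀ k i, G.Adj k i → -(|J k i| * z k) ≤ m k i * z i) {i j : V} (hij : G.Adj i j) :
    |J i j| * z j < cavity G J.diag m i j * z i := by
  have h1 := hz i
  rw [sum_neighborFinset_eq_add_sum_erase (fun k => |J i k| * z k) hij] at h1
  have h2 : -∑ k ∈ (G.neighborFinset i).erase j, |J i k| * z k
      ≤ ∑ k ∈ (G.neighborFinset i).erase j, m k i * z i := by
    rw [← Finset.sum_neg_distrib]
    refine Finset.sum_le_sum fun k hk => ?_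
    have hik : G.Adj k i := by
      have := (Finset.mem_erase.1 hk).2
      exact ((G.mem_neighborFinset _ _).1 this).symm
    rw [hJ.symm i k]
    exact hm k i hik
  rw [cavity, Matrix.diag_apply, hJ.diag, add_mul, Finset.sum_mul]
  linarith

theorem IsNormalizedModel.marginal_pos (hJ : IsNormalizedModel G J) {z : V → ℝ}
    {m : V → V → ℝ} (hz0 : ∀ i, 0 < z i)
    (hz : ∀ i, ∑ k ∈ G.neighborFinset i, |J i k| * z k < z i)
    (hm : ∀ k i, G.Adj k i → -(|J k i| * z k) ≤ m k i * z i) (i : V) :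
    0 < marginal G J.diag m i := by
  refine pos_of_mul_pos_left ?_ (hz0 i).le
  have h2 : -∑ k ∈ G.neighborFinset i, |J i k| * z k
      ≤ ∑ k ∈ G.neighborFinset i, m k i * z i := by
    rw [← Finset.sum_neg_distrib]
    refine Finset.sum_le_sum fun k hk => ?_
    rw [hJ.symm i k]
    exact hm k i ((G.mem_neighborFinset _ _).1 hk).symm
  rw [marginal, Matrix.diag_apply, hJ.diag, add_mul, Finset.sum_mul]
  linarith [hz i]

theorem IsNormalizedModel.messageJ_succ (hJ : IsNormalizedModel G J) (t : ℕ) (i j : V) :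
    messageJ G J (t + 1) i j
      = -(J i j ^ 2 * (cavity G J.diag (messageJ G J t) i j)⁻¹) := by
  simp only [messageJ, hJ.symm j i]
  ring

/-- The bound reproduces itself: the margin in `cavity_lower_bound`, multiplied by `|J i j|`, is the
bound for the outgoing message. -/
theorem IsNormalizedModel.messageJ_lower_bound (hJ : IsNormalizedModel G J) {z : V → ℝ}
    (hz0 : ∀ i, 0 < z i) (hz : ∀ i, ∑ k ∈ G.neighborFinset i, |J i k| * z k < z i) (t : ℕ) :
    ∀ i j, G.Adj i j → -(|J i j| * z i) ≤ messageJ G J t i j * z j := by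
  induction t with
  | zero =>
    intro i j _
    have := mul_nonneg (abs_nonneg (J i j)) (hz0 i).le
    simpa [messageJ] using this
  | succ t ih =>
    intro i j hij
    have hc := hJ.cavity_lower_bound hz ih hij
    have hr : 0 ≤ |J i j| * z j := mul_nonneg (abs_nonneg _) (hz0 j).le
    have hc0 : 0 < cavity G J.diag (messageJ G J t) i j :=
      pos_of_mul_pos_left (hr.trans_lt hc) (hz0 i).le
    rw [hJ.messageJ_succ, ← sq_abs, neg_mul, neg_le_neg_iff, ← div_eq_mul_inv, div_mul_eq_mul_div,
      div_le_iff₀ hc0]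
    nlinarith [mul_le_mul_of_nonneg_left hc.le (abs_nonneg (J i j))]

theorem IsNormalizedModel.cavity_messageJ_pos (hJ : IsNormalizedModel G J) {z : V → ℝ}
    (hz0 : ∀ i, 0 < z i) (hz : ∀ i, ∑ k ∈ G.neighborFinset i, |J i k| * z k < z i) (t : ℕ)
    {i j : V} (hij : G.Adj i j) : 0 < cavity G J.diag (messageJ G J t) i j :=
  pos_of_mul_pos_left ((mul_nonneg (abs_nonneg _) (hz0 j).le).trans_lt
    (hJ.cavity_lower_bound hz (hJ.messageJ_lower_bound hz0 hz t) hij)) (hz0 i).le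

theorem cavity_mono {a : V → ℝ} {m m' : V → V → ℝ} {i : V}
    (h : ∀ k, G.Adj k i → m k i ≤ m' k i) (j : V) : cavity G a m i j ≤ cavity G a m' i j := by
  unfold cavity
  gcongr with k hk
  exact h k ((G.mem_neighborFinset _ _).1 (Finset.mem_erase.1 hk).2).symm

/-- On positive cavities the update is monotone in the messages, and the first update from zero is
nonpositive. -/
theorem IsNormalizedModel.messageJ_succ_le (hJ : IsNormalizedModel G J) {z : V → ℝ}
    (hz0 : ∀ i, 0 < z i) (hz : ∀ i, ∑ k ∈ G.neighborFinset i, |J i k| * z k < z i) (t : ℕ) :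
    ∀ i j, G.Adj i j → messageJ G J (t + 1) i j ≤ messageJ G J t i j := by
  induction t with
  | zero =>
    intro i j hij
    rw [hJ.messageJ_succ]
    have := hJ.cavity_messageJ_pos hz0 hz 0 hij
    simp only [messageJ, Left.neg_nonpos_iff] at this ⊢
    positivity
  | succ t ih =>
    intro i j hij
    rw [hJ.messageJ_succ, hJ.messageJ_succ]
    have h1 := hJ.cavity_messageJ_pos hz0 hz (t + 1) hij
    have h2 : cavity G J.diag (messageJ G J (t + 1)) i j ≤ cavity G J.diag (messageJ G J t) i j :=
      cavity_mono (fun k hk => ih k i hk) j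
    gcongr

theorem IsNormalizedModel.messageJ_antitone (hJ : IsNormalizedModel G J) {z : V → ℝ}
    (hz0 : ∀ i, 0 < z i) (hz : ∀ i, ∑ k ∈ G.neighborFinset i, |J i k| * z k < z i)
    {i j : V} (hij : G.Adj i j) : Antitone fun t => messageJ G J t i j :=
  antitone_nat_of_succ_le fun t => hJ.messageJ_succ_le hz0 hz t i j hij

theorem IsNormalizedModel.tendsto_messageJ (hJ : IsNormalizedModel G J) {z : V → ℝ}
    (hz0 : ∀ i, 0 < z i) (hz : ∀ i, ∑ k ∈ G.neighborFinset i, |J i k| * z k < z i)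
    {i j : V} (hij : G.Adj i j) :
    Tendsto (fun t => messageJ G J t i j) atTop (𝓝 (fixedJ G J i j)) := by
  refine tendsto_nhds_limUnder ⟨_, tendsto_atTop_ciInf (hJ.messageJ_antitone hz0 hz hij)
    ⟨-(|J i j| * z i) / z j, ?_⟩⟩
  rintro _ ⟨t, rfl⟩
  exact (div_le_iff₀ (hz0 j)).2 (hJ.messageJ_lower_bound hz0 hz t i j hij)

theorem IsNormalizedModel.fixedJ_le_messageJ (hJ : IsNormalizedModel G J) {z : V → ℝ}
    (hz0 : ∀ i, 0 < z i) (hz : ∀ i, ∑ k ∈ G.neighborFinset i, |J i k| * z k < z i)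
    {i j : V} (hij : G.Adj i j) (t : ℕ) : fixedJ G J i j ≤ messageJ G J t i j :=
  (hJ.messageJ_antitone hz0 hz hij).le_of_tendsto (hJ.tendsto_messageJ hz0 hz hij) t

theorem IsNormalizedModel.fixedJ_lower_bound (hJ : IsNormalizedModel G J) {z : V → ℝ}
    (hz0 : ∀ i, 0 < z i) (hz : ∀ i, ∑ k ∈ G.neighborFinset i, |J i k| * z k < z i)
    (i j : V) (hij : G.Adj i j) : -(|J i j| * z i) ≤ fixedJ G J i j * z j :=
  ge_of_tendsto' ((hJ.tendsto_messageJ hz0 hz hij).mul_const _)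
    fun t => hJ.messageJ_lower_bound hz0 hz t i j hij

theorem IsNormalizedModel.cavity_fixedJ_pos (hJ : IsNormalizedModel G J) {z : V → ℝ}
    (hz0 : ∀ i, 0 < z i) (hz : ∀ i, ∑ k ∈ G.neighborFinset i, |J i k| * z k < z i)
    {i j : V} (hij : G.Adj i j) : 0 < cavity G J.diag (fixedJ G J) i j :=
  pos_of_mul_pos_left ((mul_nonneg (abs_nonneg _) (hz0 j).le).trans_lt
    (hJ.cavity_lower_bound hz (hJ.fixedJ_lower_bound hz0 hz) hij)) (hz0 i).le

theorem tendsto_cavity {a : V → ℝ} {m : ℕ → V → V → ℝ} {m' : V → V → ℝ}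
    (h : ∀ i j, G.Adj i j → Tendsto (fun t => m t i j) atTop (𝓝 (m' i j))) (i j : V) :
    Tendsto (fun t => cavity G a (m t) i j) atTop (𝓝 (cavity G a m' i j)) :=
  (tendsto_finsetSum _ fun k hk =>
    h k i ((G.mem_neighborFinset _ _).1 (Finset.mem_erase.1 hk).2).symm).const_add _

theorem IsNormalizedModel.fixedJ_eq (hJ : IsNormalizedModel G J)
    (hJt : ∀ i j, G.Adj i j → Tendsto (fun t => messageJ G J t i j) atTop (𝓝 (fixedJ G J i j)))
    (hc : ∀ i j, G.Adj i j → cavity G J.diag (fixedJ G J) i j ≠ 0) {i j : V} (hij : G.Adj i j) :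
    fixedJ G J i j = -(J i j ^ 2 * (cavity G J.diag (fixedJ G J) i j)⁻¹) := by
  refine tendsto_nhds_unique ((tendsto_add_atTop_iff_nat 1).2 (hJt i j hij)) ?_
  simp only [hJ.messageJ_succ]
  exact (((tendsto_cavity hJt i j).inv₀ (hc i j hij)).const_mul _).neg

theorem fixedH_eq {h : V → ℝ}
    (hJt : ∀ i j, G.Adj i j → Tendsto (fun t => messageJ G J t i j) atTop (𝓝 (fixedJ G J i j)))
    (hHt : ∀ i j, G.Adj i j → Tendsto (fun t => messageH G J h t i j) atTop
      (𝓝 (fixedH G J h i j)))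
    (hc : ∀ i j, G.Adj i j → cavity G J.diag (fixedJ G J) i j ≠ 0) {i j : V} (hij : G.Adj i j) :
    fixedH G J h i j = -(J j i * (cavity G J.diag (fixedJ G J) i j)⁻¹ *
      cavity G h (fixedH G J h) i j) := by
  refine tendsto_nhds_unique ((tendsto_add_atTop_iff_nat 1).2 (hHt i j hij)) ?_
  simp only [messageH]
  exact ((((tendsto_cavity hJt i j).inv₀ (hc i j hij)).const_mul _).mul
    (tendsto_cavity hHt i j)).neg

/-- The messages `Δh` for nonnegative edge weights `|R|` and potentials `|h|`. -/
noncomputable def absMessageH (G : SimpleGraph V) [DecidableRel G.Adj] (J : Matrix V V ℝ)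
    (h : V → ℝ) : ℕ → V → V → ℝ
  | 0 => fun _ _ => 0
  | t + 1 => fun i j => |J j i| * (cavity G J.diag (messageJ G J t) i j)⁻¹ *
      cavity G (fun i => |h i|) (absMessageH G J h t) i j

theorem messageH_succ (h : V → ℝ) (t : ℕ) (i j : V) :
    messageH G J h (t + 1) i j = -(J j i * (cavity G J.diag (messageJ G J t) i j)⁻¹ *
      cavity G h (messageH G J h t) i j) := rfl

theorem absMessageH_succ (h : V → ℝ) (t : ℕ) (i j : V) :
    absMessageH G J h (t + 1) i j = |J j i| * (cavity G J.diag (messageJ G J t) i j)⁻¹ *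
      cavity G (fun i => |h i|) (absMessageH G J h t) i j := rfl

theorem abs_cavity_le {a b : V → ℝ} {m m' : V → V → ℝ} {i : V} (hab : |a i| ≤ b i)
    (h : ∀ k, G.Adj k i → |m k i| ≤ m' k i) (j : V) :
    |cavity G a m i j| ≤ cavity G b m' i j := by
  unfold cavity
  refine (abs_add_le _ _).trans (add_le_add hab ((Finset.abs_sum_le_sum_abs _ _).trans
    (Finset.sum_le_sum fun k hk => ?_)))
  exact h k ((G.mem_neighborFinset _ _).1 (Finset.mem_erase.1 hk).2).symm

theorem cavity_sub_cavity (a : V → ℝ) (m m' : V → V → ℝ) (i j : V) :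
    cavity G a m i j - cavity G a m' i j = cavity G 0 (m - m') i j := by
  simp [cavity]

theorem abs_cavity_sub_le (a b : V → ℝ) {m m' n n' : V → V → ℝ} {i : V}
    (h : ∀ k, G.Adj k i → |m k i - m' k i| ≤ n k i - n' k i) (j : V) :
    |cavity G a m i j - cavity G a m' i j| ≤ cavity G b n i j - cavity G b n' i j := by
  rw [cavity_sub_cavity, cavity_sub_cavity]
  exact abs_cavity_le (by simp) (fun k hk => by simpa using h k hk) j

theorem IsNormalizedModel.abs_messageH_le (hJ : IsNormalizedModel G J) {z : V → ℝ}
    (hz0 : ∀ i, 0 < z i) (hz : ∀ i, ∑ k ∈ G.neighborFinset i, |J i k| * z k < z i)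
    (h : V → ℝ) (t : ℕ) :
    ∀ i j, G.Adj i j → |messageH G J h t i j| ≤ absMessageH G J h t i j := by
  induction t with
  | zero => intro i j _; simp [messageH, absMessageH]
  | succ t ih =>
    intro i j hij
    have hc := hJ.cavity_messageJ_pos hz0 hz t hij
    rw [messageH_succ, absMessageH_succ, abs_neg, abs_mul, abs_mul, abs_of_pos (inv_pos.2 hc)]
    have := abs_cavity_le (b := fun i => |h i|) le_rfl (fun k hk => ih k i hk) j
    gcongr

/-- An increment splits into the change of the reciprocal cavity, which is nonnegative, and the
change of the cavity potential. Both parts are dominated by their counterparts in the comparison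
recursion, whose increments telescope. -/
theorem IsNormalizedModel.abs_messageH_succ_sub_le (hJ : IsNormalizedModel G J) {z : V → ℝ}
    (hz0 : ∀ i, 0 < z i) (hz : ∀ i, ∑ k ∈ G.neighborFinset i, |J i k| * z k < z i)
    (h : V → ℝ) (t : ℕ) :
    ∀ i j, G.Adj i j → |messageH G J h (t + 1) i j - messageH G J h t i j|
      ≤ absMessageH G J h (t + 1) i j - absMessageH G J h t i j := by
  induction t with
  | zero =>
    intro i j hij
    have := hJ.abs_messageH_le hz0 hz h 1 i j hij
    rw [messageH.eq_def G J h 0, absMessageH.eq_def G J h 0]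
    simpa using this
  | succ t ih =>
    intro i j hij
    have hc := hJ.cavity_messageJ_pos hz0 hz t hij
    have hc' := hJ.cavity_messageJ_pos hz0 hz (t + 1) hij
    have hcc : cavity G J.diag (messageJ G J (t + 1)) i j ≤ cavity G J.diag (messageJ G J t) i j :=
      cavity_mono (fun k hk => hJ.messageJ_succ_le hz0 hz t k i hk) j
    have hK := abs_cavity_le (a := h) (b := fun i => |h i|) le_rfl
      (fun k hk => hJ.abs_messageH_le hz0 hz h (t + 1) k i hk) j
    have hD := abs_cavity_sub_le h (fun i => |h i|) (fun k hk => ih k i hk) j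
    have hs := inv_anti₀ hc' hcc
    rw [messageH_succ h (t + 1), messageH_succ h t, absMessageH_succ h (t + 1),
      absMessageH_succ h t]
    have hs0 := inv_pos.2 hc
    generalize (cavity G J.diag (messageJ G J (t + 1)) i j)⁻¹ = s' at *
    generalize (cavity G J.diag (messageJ G J t) i j)⁻¹ = s at *
    generalize cavity G h (messageH G J h (t + 1)) i j = H' at *
    generalize cavity G h (messageH G J h t) i j = H at *
    generalize cavity G _ (absMessageH G J h (t + 1)) i j = K' at *
    generalize cavity G _ (absMessageH G J h t) i j = K at *
    calc |-(J j i * s' * H') - -(J j i * s * H)|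
        = |J j i| * |(s' - s) * H' + s * (H' - H)| := by
          rw [← abs_mul, ← abs_neg]; congr 1; ring
      _ ≤ |J j i| * ((s' - s) * K' + s * (K' - K)) := by
          gcongr
          refine (abs_add_le _ _).trans ?_
          rw [abs_mul, abs_mul, abs_of_nonneg (sub_nonneg.2 hs), abs_of_pos hs0]
          have := sub_nonneg.2 hs
          gcongr
      _ = |J j i| * s' * K' - |J j i| * s * K := by ring

/-- The bound is a supersolution of the comparison recursion. With `c` the limit cavity, `fixedJ_eq`
turns it into `|J i j| * c⁻¹ * (c * z i - |J i j| * z j)`, and `c⁻¹` dominates the reciprocal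
cavities at all times. -/
theorem IsNormalizedModel.absMessageH_le (hJ : IsNormalizedModel G J) {z h : V → ℝ}
    (hz0 : ∀ i, 0 < z i) (hz : ∀ i, ∑ k ∈ G.neighborFinset i, |J i k| * z k < z i)
    (hzh : ∀ i, |h i| + ∑ k ∈ G.neighborFinset i, |J i k| * z k ≤ z i) (t : ℕ) :
    ∀ i j, G.Adj i j → absMessageH G J h t i j ≤ |J i j| * z i + fixedJ G J i j * z j := by
  induction t with
  | zero =>
    intro i j hij
    have := hJ.fixedJ_lower_bound hz0 hz i j hij
    simp only [absMessageH]
    linarith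
  | succ t ih =>
    intro i j hij
    have hc := hJ.cavity_messageJ_pos hz0 hz t hij
    have hc' := hJ.cavity_fixedJ_pos hz0 hz hij
    have hcc : cavity G J.diag (fixedJ G J) i j ≤ cavity G J.diag (messageJ G J t) i j :=
      cavity_mono (fun k hk => hJ.fixedJ_le_messageJ hz0 hz hk t) j
    have hfix := hJ.fixedJ_eq (fun i j hij => hJ.tendsto_messageJ hz0 hz hij)
      (fun i j hij => (hJ.cavity_fixedJ_pos hz0 hz hij).ne') hij
    have hK0 : 0 ≤ cavity G (fun i => |h i|) (absMessageH G J h t) i j :=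
      (abs_nonneg _).trans (abs_cavity_le (a := h) le_rfl
        (fun k hk => hJ.abs_messageH_le hz0 hz h t k i hk) j)
    have hK : cavity G (fun i => |h i|) (absMessageH G J h t) i j
        ≤ cavity G J.diag (fixedJ G J) i j * z i - |J i j| * z j := by
      have h1 := hzh i
      rw [sum_neighborFinset_eq_add_sum_erase (fun k => |J i k| * z k) hij] at h1
      have h2 : ∑ k ∈ (G.neighborFinset i).erase j, absMessageH G J h t k i
          ≤ ∑ k ∈ (G.neighborFinset i).erase j, (|J i k| * z k + fixedJ G J k i * z i) := by
        refine Finset.sum_le_sum fun k hk => ?_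
        rw [hJ.symm i k]
        exact ih k i ((G.mem_neighborFinset _ _).1 (Finset.mem_erase.1 hk).2).symm
      rw [Finset.sum_add_distrib, ← Finset.sum_mul] at h2
      rw [cavity, cavity, Matrix.diag_apply, hJ.diag]
      linarith
    rw [absMessageH_succ, hfix, hJ.symm j i]
    calc |J i j| * (cavity G J.diag (messageJ G J t) i j)⁻¹ *
          cavity G (fun i => |h i|) (absMessageH G J h t) i j
        ≤ |J i j| * (cavity G J.diag (fixedJ G J) i j)⁻¹ *
          (cavity G J.diag (fixedJ G J) i j * z i - |J i j| * z j) := by gcongr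
      _ = _ := by
        rw [← sq_abs (J i j)]
        field_simp
        ring

theorem IsNormalizedModel.tendsto_messageH (hJ : IsNormalizedModel G J) {z h : V → ℝ}
    (hz0 : ∀ i, 0 < z i) (hz : ∀ i, ∑ k ∈ G.neighborFinset i, |J i k| * z k < z i)
    (hzh : ∀ i, |h i| + ∑ k ∈ G.neighborFinset i, |J i k| * z k ≤ z i) {i j : V}
    (hij : G.Adj i j) : ∃ a, Tendsto (fun t => messageH G J h t i j) atTop (𝓝 a) := by
  refine cauchySeq_tendsto_of_complete (cauchySeq_of_summable_dist ?_)
  refine summable_of_sum_range_le (c := |J i j| * z i + fixedJ G J i j * z j)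
    (fun _ => dist_nonneg) fun n => ?_
  calc _ ≤ ∑ t ∈ Finset.range n, (absMessageH G J h (t + 1) i j - absMessageH G J h t i j) := by
        refine Finset.sum_le_sum fun t _ => ?_
        rw [dist_comm, Real.dist_eq]
        exact hJ.abs_messageH_succ_sub_le hz0 hz h t i j hij
    _ = absMessageH G J h n i j := by
        rw [Finset.sum_range_sub (fun t => absMessageH G J h t i j)]
        simp [absMessageH]
    _ ≤ _ := hJ.absMessageH_le hz0 hz hzh n i j hij

theorem IsNormalizedModel.lbpConverges (hJ : IsNormalizedModel G J) {z h : V → ℝ}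
    (hz0 : ∀ i, 0 < z i) (hz : ∀ i, ∑ k ∈ G.neighborFinset i, |J i k| * z k < z i)
    (hzh : ∀ i, |h i| + ∑ k ∈ G.neighborFinset i, |J i k| * z k ≤ z i) :
    LBPConverges G J h where
  cavity_ne_zero t _ _ hij := (hJ.cavity_messageJ_pos hz0 hz t hij).ne'
  tendsto_J _ _ hij := ⟨_, hJ.tendsto_messageJ hz0 hz hij⟩
  tendsto_H _ _ hij := hJ.tendsto_messageH hz0 hz hzh hij
  marginal_ne_zero i := (hJ.marginal_pos hz0 hz (hJ.fixedJ_lower_bound hz0 hz) i).ne'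

/-! ### Exactness of the LBP means. -/

theorem IsNormalizedModel.mulVec_apply (hJ : IsNormalizedModel G J) (x : V → ℝ) (i : V) :
    J.mulVec x i = x i + ∑ k ∈ G.neighborFinset i, J i k * x k := by
  have hi : i ∉ G.neighborFinset i := by simp
  rw [Matrix.mulVec, dotProduct, ← Finset.sum_subset (Finset.subset_univ
    (insert i (G.neighborFinset i))), Finset.sum_insert hi, hJ.diag, one_mul]
  intro k _ hk
  rw [Finset.mem_insert, not_or, G.mem_neighborFinset] at hk
  rw [hJ.markov i k (Ne.symm hk.1) hk.2, zero_mul]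

/-- If LBP converges then the means it computes are exact. -/
theorem IsNormalizedModel.mulVec_lbpMean (hJ : IsNormalizedModel G J) {h : V → ℝ}
    (hL : LBPConverges G J h) (hc : ∀ i j, G.Adj i j → cavity G J.diag (fixedJ G J) i j ≠ 0) :
    J.mulVec (lbpMean G J h) = h := by
  have hJt : ∀ i j, G.Adj i j →
      Tendsto (fun t => messageJ G J t i j) atTop (𝓝 (fixedJ G J i j)) :=
    fun i j hij => tendsto_nhds_limUnder (hL.tendsto_J i j hij)
  have hHt : ∀ i j, G.Adj i j →
      Tendsto (fun t => messageH G J h t i j) atTop (𝓝 (fixedH G J h i j)) :=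
    fun i j hij => tendsto_nhds_limUnder (hL.tendsto_H i j hij)
  have hM := hL.marginal_ne_zero
  set x := lbpMean G J h with hx
  have hmx : ∀ i, marginal G J.diag (fixedJ G J) i * x i = marginal G h (fixedH G J h) i := by
    intro i
    rw [hx, lbpMean, mul_inv_cancel_left₀ (hM i)]
  -- The expression in parentheses is the error made when the message from `i` stands in for the
  -- term `J i j * x i` in row `j` of `J x`.
  have key : ∀ i j, G.Adj i j →
      cavity G J.diag (fixedJ G J) i j * (fixedH G J h i j - fixedJ G J i j * x j + J i j * x i)
        = J i j * (fixedH G J h j i - fixedJ G J j i * x i + J i j * x j) := by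
    intro i j hij
    have h1 := hmx i
    rw [marginal_eq_cavity_add _ _ hij, marginal_eq_cavity_add _ _ hij] at h1
    have h2 := hJ.fixedJ_eq hJt hc hij
    have h3 := fixedH_eq hJt hHt hc hij
    have h0 := hc i j hij
    rw [eq_neg_iff_add_eq_zero] at h2 h3
    field_simp at h2 h3
    rw [hJ.symm j i] at *
    linear_combination h3 - x j * h2 + J i j * h1
  -- Using `key` in both directions leaves the error times `c i j * c j i - J i j ^ 2`, where `c` is
  -- the cavity. This factor equals `c i j` times the marginal at `j`, so it is nonzero.
  have hD : ∀ i j, G.Adj i j → fixedH G J h i j - fixedJ G J i j * x j + J i j * x i = 0 := by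
    intro i j hij
    have h1 := key i j hij
    have h2 := key j i hij.symm
    have h3 := hJ.fixedJ_eq hJt hc hij
    have h0 := hc i j hij
    have h4 := hM j
    rw [marginal_eq_cavity_add _ _ hij.symm] at h4
    rw [eq_neg_iff_add_eq_zero] at h3
    field_simp at h3
    rw [hJ.symm j i] at h2
    have : (cavity G J.diag (fixedJ G J) i j *
        (cavity G J.diag (fixedJ G J) j i + fixedJ G J i j)) *
        (fixedH G J h i j - fixedJ G J i j * x j + J i j * x i) = 0 := by
      linear_combination cavity G J.diag (fixedJ G J) j i * h1 + J i j * h2 +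
        (fixedH G J h i j - fixedJ G J i j * x j + J i j * x i) * h3
    exact (mul_eq_zero.1 this).resolve_left (mul_ne_zero h0 h4)
  funext i
  have h1 := hmx i
  rw [marginal, marginal, Matrix.diag_apply, hJ.diag] at h1
  have h2 : ∑ k ∈ G.neighborFinset i, J i k * x k
      = (∑ k ∈ G.neighborFinset i, fixedJ G J k i) * x i
        - ∑ k ∈ G.neighborFinset i, fixedH G J h k i := by
    rw [Finset.sum_mul, ← Finset.sum_sub_distrib]
    refine Finset.sum_congr rfl fun k hk => ?_
    have := hD k i ((G.mem_neighborFinset _ _).1 hk).symm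
    rw [hJ.symm i k]
    linear_combination this
  rw [hJ.mulVec_apply, h2]
  linear_combination h1

end Convergence

/-! ### Backtracking walks as binary trees. -/

section Trees

variable {V : Type*} {G : SimpleGraph V}

/-- Binary trees that encode the backtracking walks from `i` to `i` whose reduced form never
starts with the node in `o`: such a walk is trivial, or it consists of a step to some `k`, a
backtracking walk of `k` that does not step to `i`, a step back, and a remainder. -/
inductive BacktrackTree (G : SimpleGraph V) : V → Option V → Type _
  | nil (i : V) (o : Option V) : BacktrackTree G i o
  | cons {i : V} {o : Option V} (k : V) (hik : G.Adj i k) (hk : some k ≠ o)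
      (A : BacktrackTree G k (some i)) (B : BacktrackTree G i o) : BacktrackTree G i o

namespace BacktrackTree

/-- The nodes visited after the start. -/
def word : {i : V} → {o : Option V} → BacktrackTree G i o → List V
  | _, _, nil _ _ => []
  | i, _, cons k _ _ A B => k :: (A.word ++ i :: B.word)

/-- The walk that is encoded by a tree. -/
def toWalk : {i : V} → {o : Option V} → BacktrackTree G i o → G.Walk i i
  | _, _, nil _ _ => .nil
  | _, _, cons _ hik _ A B => .cons hik (A.toWalk.append (.cons hik.symm B.toWalk))

theorem support_toWalk {i : V} {o : Option V} (T : BacktrackTree G i o) :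
    T.toWalk.support = i :: T.word := by
  induction T with
  | nil i o => rfl
  | cons k hik hk A B ihA ihB =>
    simp [toWalk, word, SimpleGraph.Walk.support_append, ihA, ihB]

/-- Words can be parsed from the left, up to a suffix that is empty or starts with the
forbidden node. -/
theorem eq_of_word_append_eq {i : V} {o : Option V} (T : BacktrackTree G i o) :
    ∀ (T' : BacktrackTree G i o) (e e' : List V), e.head? = o → e'.head? = o →
      T.word ++ e = T'.word ++ e' → T = T' ∧ e = e' := by
  induction T with
  | nil i o =>
    intro T' e e' he he' h
    cases T' with
    | nil => exact ⟨rfl, by simpa [word] using h⟩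
    | cons k hik hk A B =>
      simp only [word, List.nil_append] at h
      subst h
      exact absurd he (by simpa using hk)
  | @cons i o k hik hk A B ihA ihB =>
    intro T' e e' he he' h
    cases T' with
    | nil =>
      simp only [word, List.nil_append] at h
      subst h
      exact absurd he' (by simpa using hk)
    | cons k' hik' hk' A' B' =>
      simp only [word, List.cons_append, List.append_assoc, List.cons.injEq] at h
      obtain ⟨rfl, h⟩ := h
      -- The suffix after `A` starts with `i`, the node forbidden to `A`; this marks where `A` ends.
      obtain ⟨rfl, h₁⟩ := ihA A' _ _ rfl rfl h
      obtain ⟨rfl, h₂⟩ := ihB B' e e' he he' (by simpa using h₁)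
      exact ⟨rfl, h₂⟩

theorem word_injective {i : V} :
    Function.Injective (word : BacktrackTree G i none → List V) := fun T T' h =>
  (T.eq_of_word_append_eq T' [] [] rfl rfl (by simpa using h)).1

theorem toWalk_injective {i : V} :
    Function.Injective (toWalk : BacktrackTree G i none → G.Walk i i) := fun T T' h =>
  word_injective (by simpa [support_toWalk] using congrArg SimpleGraph.Walk.support h)

/-- Inserting an immediate backtrack into the word of a tree. -/
theorem exists_insert {i : V} {o : Option V} (T : BacktrackTree G i o) :
    ∀ (x y : List V) (a b : V), T.word = x ++ y → (i :: x).getLast (by simp) = a → G.Adj a b →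
      (∃ T' : BacktrackTree G i o, T'.word = x ++ b :: a :: y) ∨
      (a = i ∧ o = some b ∧ ∃ T₁ T₂ : BacktrackTree G i o, T₁.word = x ∧ T₂.word = y) := by
  induction T with
  | nil i o =>
    intro x y a b h ha hab
    obtain ⟨rfl, rfl⟩ : x = [] ∧ y = [] := by simpa [word, eq_comm] using h
    obtain rfl : i = a := by simpa using ha
    -- A new excursion to `b` can be planted at the root unless `b` is forbidden there. In that case
    -- the split of the word is handed to the parent.
    by_cases hb : some b = o
    · exact .inr ⟨rfl, hb.symm, nil _ _, nil _ _, rfl, rfl⟩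
    · exact .inl ⟨cons b hab hb (nil _ _) (nil _ _), rfl⟩
  | @cons i o k hik hk A B ihA ihB =>
    intro x y a b h ha hab
    simp only [word] at h
    rcases x with _ | ⟨k', x⟩
    · obtain rfl : i = a := by simpa using ha
      by_cases hb : some b = o
      · exact .inr ⟨rfl, hb.symm, nil _ _, cons k hik hk A B, rfl, by simpa [word] using h⟩
      · exact .inl ⟨cons b hab hb (nil _ _) (cons k hik hk A B), by simpa [word] using h⟩
    · simp only [List.cons_append, List.cons.injEq] at h
      obtain ⟨rfl, h⟩ := h
      rw [List.getLast_cons (by simp)] at ha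
      rcases List.append_eq_append_iff.1 h with ⟨s, rfl, hs⟩ | ⟨s, hA, rfl⟩
      · rcases s with _ | ⟨i', s⟩
        · simp only [List.append_nil, List.nil_append] at *
          subst hs
          obtain ⟨A', hA'⟩ | ⟨rfl, hib, A₁, A₂, h₁, h₂⟩ := ihA A.word [] a b (by simp) ha hab
          · exact .inl ⟨cons k hik hk A' B, by simp [word, hA']⟩
          · obtain rfl : i = b := by simpa using hib
            -- An inserted return to `i` in the middle of the excursion to `a` cuts it into two
            -- successive excursions.
            exact .inl ⟨cons a hik hk A₁ (cons a hik hk A₂ B), by simp [word, h₁, h₂]⟩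
        · simp only [List.cons_append, List.cons.injEq] at hs
          obtain ⟨rfl, hs⟩ := hs
          have ha' : (i :: s).getLast (by simp) = a := by
            rw [← ha]
            simp
          obtain ⟨B', hB'⟩ | ⟨rfl, hob, B₁, B₂, h₁, h₂⟩ := ihB s y a b hs ha' hab
          · exact .inl ⟨cons k hik hk A B', by simp [word, hB']⟩
          · exact .inr ⟨rfl, hob, cons k hik hk A B₁, B₂, by simp [word, h₁], h₂⟩
      · obtain ⟨A', hA'⟩ | ⟨rfl, hib, A₁, A₂, h₁, h₂⟩ := ihA x s a b hA ha hab
        · exact .inl ⟨cons k hik hk A' B, by simp [word, hA']⟩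
        · obtain rfl : i = b := by simpa using hib
          exact .inl ⟨cons a hik hk A₁ (cons a hik hk A₂ B), by simp [word, h₁, h₂]⟩

end BacktrackTree

theorem WalkReduces.append_left {u v w : V} (p : G.Walk u v) {q q' : G.Walk v w}
    (h : WalkReduces q q') : WalkReduces (p.append q) (p.append q') := by
  obtain ⟨r, hab, s⟩ := h
  rw [SimpleGraph.Walk.append_assoc, SimpleGraph.Walk.append_assoc]
  exact .step _ hab s

theorem WalkReduces.append_right {u v w : V} {p p' : G.Walk u v} (q : G.Walk v w)
    (h : WalkReduces p p') : WalkReduces (p.append q) (p'.append q) := by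
  obtain ⟨r, hab, s⟩ := h
  rw [← SimpleGraph.Walk.append_assoc, ← SimpleGraph.Walk.append_assoc]
  exact .step r hab _

/-- The excursion `A` is contracted first, then the step out and back, then `B`. -/
theorem BacktrackTree.isBacktracking_toWalk {i : V} {o : Option V} (T : BacktrackTree G i o) :
    IsBacktracking T.toWalk := by
  induction T with
  | nil i o => exact .refl
  | @cons i o k hik hk A B ihA ihB =>
    have h1 : Relation.ReflTransGen WalkReduces (toWalk (cons k hik hk A B))
        (.cons hik (.cons hik.symm B.toWalk)) :=
      Relation.ReflTransGen.lift
        (fun w : G.Walk k k => SimpleGraph.Walk.cons hik (w.append (.cons hik.symm B.toWalk)))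
        (fun _ _ h => (h.append_right _).append_left (.cons hik .nil)) _ _ ihA
    exact (h1.tail (.step .nil hik B.toWalk)).trans ihB

/-- Reductions are undone one at a time, starting from the trivial walk. Each is an insertion as in
`exists_insert`, whose exceptional case needs a forbidden node at the root. -/
theorem IsBacktracking.exists_tree {i : V} {w : G.Walk i i} (hw : IsBacktracking w) :
    ∃ T : BacktrackTree G i none, T.toWalk = w := by
  induction hw using Relation.ReflTransGen.head_induction_on with
  | refl => exact ⟨.nil _ _, rfl⟩
  | head h _ ih =>
    obtain @⟨a, b, p, hab, q⟩ := h
    obtain ⟨T, hT⟩ := ih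
    have hT := congrArg SimpleGraph.Walk.support hT
    rw [T.support_toWalk, SimpleGraph.Walk.support_append, ← SimpleGraph.Walk.cons_tail_support p,
      List.cons_append, List.cons.injEq] at hT
    have hl : (i :: p.support.tail).getLast (by simp) = a := by
      have := p.getLast_support
      simpa only [SimpleGraph.Walk.cons_tail_support] using this
    obtain ⟨T', hT'⟩ | ⟨_, h, _⟩ := T.exists_insert _ _ _ _ hT.2 hl hab
    · refine ⟨T', SimpleGraph.Walk.ext_support ?_⟩
      rw [T'.support_toWalk, hT', SimpleGraph.Walk.support_append,
        ← List.cons_append, SimpleGraph.Walk.cons_tail_support]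
      simp
    · simp at h

/-- Backtracking walks correspond to trees. -/
noncomputable def treeEquivLbpWalks (G : SimpleGraph V) (i : V) :
    BacktrackTree G i none ≃ lbpWalks G i :=
  Equiv.ofBijective (fun T => ⟨T.toWalk, T.isBacktracking_toWalk⟩)
    ⟨fun _ _ h => BacktrackTree.toWalk_injective (congrArg Subtype.val h),
      fun w => (IsBacktracking.exists_tree w.2).imp fun _ h => Subtype.ext h⟩

end Trees

open scoped ENNReal

/-! ### LBP variances as sums over trees. -/

section TreeSums

variable {V : Type*} [Fintype V] [DecidableEq V] {G : SimpleGraph V} [DecidableRel G.Adj]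
  {J : Matrix V V ℝ}

theorem walkWeight_append {R : Matrix V V ℝ} {u v w : V} (p : G.Walk u v) (q : G.Walk v w) :
    walkWeight R (p.append q) = walkWeight R p * walkWeight R q := by
  simp [walkWeight]

theorem walkWeight_cons {R : Matrix V V ℝ} {u v w : V} (h : G.Adj u v) (p : G.Walk v w) :
    walkWeight R (.cons h p) = R u v * walkWeight R p := by
  simp [walkWeight]

theorem walkWeight_nil {R : Matrix V V ℝ} {u : V} :
    walkWeight R (.nil : G.Walk u u) = 1 := by
  simp [walkWeight]

theorem edgeWeight_of_ne {i j : V} (h : i ≠ j) : edgeWeight J i j = -J i j := by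
  simp [edgeWeight, Matrix.one_apply_ne h]

variable (G) in
/-- The neighbors of `i` other than the one in `o`. -/
def nextNodes (i : V) (o : Option V) : Finset V :=
  (G.neighborFinset i).filter fun k => some k ≠ o

theorem mem_nextNodes {i k : V} {o : Option V} : k ∈ nextNodes G i o ↔ G.Adj i k ∧ some k ≠ o := by
  simp [nextNodes]

theorem nextNodes_some (i j : V) : nextNodes G i (some j) = (G.neighborFinset i).erase j := by
  ext k; simp [nextNodes, and_comm]

theorem nextNodes_none (i : V) : nextNodes G i none = G.neighborFinset i := by
  ext k; simp [nextNodes]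

namespace BacktrackTree

/-- Decomposition of a tree at its root. -/
def equivSum (i : V) (o : Option V) : BacktrackTree G i o ≃
    Unit ⊕ Σ k : {k // k ∈ nextNodes G i o}, BacktrackTree G k (some i) × BacktrackTree G i o where
  toFun
    | nil _ _ => .inl ()
    | cons k hik hk A B => .inr ⟨⟨k, mem_nextNodes.2 ⟨hik, hk⟩⟩, A, B⟩
  invFun
    | .inl _ => nil _ _
    | .inr ⟨k, A, B⟩ => cons k.1 (mem_nextNodes.1 k.2).1 (mem_nextNodes.1 k.2).2 A B
  left_inv T := by cases T <;> rfl
  right_inv x := by rcases x with _ | ⟨k, A, B⟩ <;> rfl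

/-- The functions `a` and `b` may differ from `f`, so that the lemma serves both the weights and the
truncated weights, where the height bound drops. -/
theorem tsum_eq {i : V} {o : Option V} {f : BacktrackTree G i o → ℝ≥0∞} {c : V → ℝ≥0∞}
    {a : ∀ k, BacktrackTree G k (some i) → ℝ≥0∞} {b : BacktrackTree G i o → ℝ≥0∞}
    (hnil : f (nil i o) = 1)
    (hcons : ∀ k hik hk A B, f (cons k hik hk A B) = c k * a k A * b B) :
    ∑' T, f T = 1 + ∑ k ∈ nextNodes G i o, c k * (∑' A, a k A) * ∑' B, b B := by
  rw [← (equivSum i o).symm.tsum_eq f, Summable.tsum_sum ENNReal.summable ENNReal.summable,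
    ENNReal.tsum_sigma', tsum_fintype, tsum_fintype,
    ← Finset.sum_coe_sort (nextNodes G i o)]
  congr 1
  · simp [equivSum, hnil]
  · refine Finset.sum_congr rfl fun k _ => ?_
    have hk := mem_nextNodes.1 k.2
    refine (ENNReal.tsum_prod (f := fun A B => f (cons k.1 hk.1 hk.2 A B))).trans ?_
    simp only [hcons, ENNReal.tsum_mul_left, ENNReal.tsum_mul_right]

/-- The weight of the walk that is encoded by a tree. -/
def weight (J : Matrix V V ℝ) : {i : V} → {o : Option V} → BacktrackTree G i o → ℝ
  | _, _, nil _ _ => 1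
  | i, _, cons k _ _ A B => J i k ^ 2 * A.weight J * B.weight J

/-- The weight of a tree, or zero if the tree has height at least `n`. -/
noncomputable def truncWeight (J : Matrix V V ℝ) :
    ℕ → {i : V} → {o : Option V} → BacktrackTree G i o → ℝ≥0∞
  | 0, _, _, _ => 0
  | _ + 1, _, _, nil _ _ => 1
  | n + 1, i, _, cons k _ _ A B =>
    ENNReal.ofReal (J i k ^ 2) * A.truncWeight J n * B.truncWeight J n

theorem weight_nonneg {i : V} {o : Option V} (T : BacktrackTree G i o) : 0 ≤ T.weight J := by
  induction T with
  | nil => simp [weight]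
  | cons k hik hk A B ihA ihB => simp only [weight]; positivity

theorem ofReal_weight_cons {i : V} {o : Option V} (k : V) (hik : G.Adj i k) (hk : some k ≠ o)
    (A : BacktrackTree G k (some i)) (B : BacktrackTree G i o) :
    ENNReal.ofReal ((cons k hik hk A B).weight J) =
      ENNReal.ofReal (J i k ^ 2) * ENNReal.ofReal (A.weight J) * ENNReal.ofReal (B.weight J) := by
  rw [weight, ENNReal.ofReal_mul (mul_nonneg (sq_nonneg _) A.weight_nonneg),
    ENNReal.ofReal_mul (sq_nonneg _)]

theorem walkWeight_toWalk (hJ : IsNormalizedModel G J) {i : V} {o : Option V}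
    (T : BacktrackTree G i o) : walkWeight (edgeWeight J) T.toWalk = T.weight J := by
  induction T with
  | nil => simp [toWalk, weight, walkWeight]
  | cons k hik hk A B ihA ihB =>
    rw [toWalk, weight, walkWeight_cons, walkWeight_append, walkWeight_cons, ihA, ihB,
      edgeWeight_of_ne hik.ne, edgeWeight_of_ne hik.ne', hJ.symm k]
    ring

theorem exists_truncWeight_eq {i : V} {o : Option V} (T : BacktrackTree G i o) :
    ∃ n, ∀ m ≥ n, T.truncWeight J m = ENNReal.ofReal (T.weight J) := by
  induction T with
  | nil =>
    refine ⟨1, fun m hm => ?_⟩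
    obtain ⟨m, rfl⟩ := Nat.exists_eq_add_of_le' hm
    simp [truncWeight, weight]
  | cons k hik hk A B ihA ihB =>
    obtain ⟨n₁, h₁⟩ := ihA
    obtain ⟨n₂, h₂⟩ := ihB
    refine ⟨max n₁ n₂ + 1, fun m hm => ?_⟩
    obtain ⟨m, rfl⟩ := Nat.exists_eq_add_of_le' hm
    rw [ofReal_weight_cons, ← add_assoc, truncWeight, h₁ _ (by omega), h₂ _ (by omega)]

end BacktrackTree

/-- The cavity value with an optional excluded neighbor. -/
noncomputable def cavityOpt (G : SimpleGraph V) [DecidableRel G.Adj] (m : V → V → ℝ) (i : V)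
    (o : Option V) : ℝ :=
  1 + ∑ k ∈ nextNodes G i o, m k i

theorem IsNormalizedModel.cavity_eq_cavityOpt (hJ : IsNormalizedModel G J) (m : V → V → ℝ)
    (i j : V) : cavity G J.diag m i j = cavityOpt G m i (some j) := by
  simp [cavity, cavityOpt, nextNodes_some, hJ.diag]

theorem IsNormalizedModel.marginal_eq_cavityOpt (hJ : IsNormalizedModel G J) (m : V → V → ℝ)
    (i : V) : marginal G J.diag m i = cavityOpt G m i none := by
  simp [marginal, cavityOpt, nextNodes_none, hJ.diag]

/-- The recursion for the tree sums: it bounds them from above by any fixed point. -/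
theorem tsum_truncWeight_le {c : V → Option V → ℝ}
    (hc : ∀ i o, (∀ j, o = some j → G.Adj i j) → 0 < c i o)
    (hfix : ∀ i o, (∀ j, o = some j → G.Adj i j) →
      c i o = 1 - ∑ k ∈ nextNodes G i o, J i k ^ 2 * (c k (some i))⁻¹) (n : ℕ) :
    ∀ i o, (∀ j, o = some j → G.Adj i j) →
      ∑' T : BacktrackTree G i o, T.truncWeight J n ≤ ENNReal.ofReal (c i o)⁻¹ := by
  induction n with
  | zero => intro i o _; simp [BacktrackTree.truncWeight]
  | succ n ih =>
    intro i o ho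
    have h0 := hc i o ho
    have hpos : ∀ k ∈ nextNodes G i o, 0 < c k (some i) := fun k hk => hc k (some i) fun j hj => by
      cases hj; exact (mem_nextNodes.1 hk).1.symm
    calc ∑' T : BacktrackTree G i o, T.truncWeight J (n + 1)
        = 1 + ∑ k ∈ nextNodes G i o, ENNReal.ofReal (J i k ^ 2) *
            (∑' A : BacktrackTree G k (some i), A.truncWeight J n) *
              ∑' B : BacktrackTree G i o, B.truncWeight J n :=
          BacktrackTree.tsum_eq (by simp [BacktrackTree.truncWeight])
            (fun _ _ _ _ _ => by rw [BacktrackTree.truncWeight])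
      _ ≤ 1 + ∑ k ∈ nextNodes G i o, ENNReal.ofReal (J i k ^ 2) *
            ENNReal.ofReal (c k (some i))⁻¹ * ENNReal.ofReal (c i o)⁻¹ := by
          gcongr with k hk
          · exact ih k (some i) fun j hj => by cases hj; exact (mem_nextNodes.1 hk).1.symm
          · exact ih i o ho
      _ = ENNReal.ofReal (1 + (∑ k ∈ nextNodes G i o, J i k ^ 2 * (c k (some i))⁻¹) *
            (c i o)⁻¹) := by
          rw [ENNReal.ofReal_add zero_le_one, ENNReal.ofReal_one, Finset.sum_mul,
            ENNReal.ofReal_sum_of_nonneg]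
          · congr 1
            refine Finset.sum_congr rfl fun k hk => ?_
            have := hpos k hk
            rw [ENNReal.ofReal_mul (by positivity), ENNReal.ofReal_mul (by positivity)]
          · intro k hk
            have := hpos k hk
            positivity
          · refine mul_nonneg (Finset.sum_nonneg fun k hk => ?_) (by positivity)
            have := hpos k hk
            positivity
      _ = ENNReal.ofReal (c i o)⁻¹ := by
          congr 1
          have := hfix i o ho
          generalize ∑ k ∈ nextNodes G i o, J i k ^ 2 * (c k (some i))⁻¹ = S at *
          field_simp
          linarith

/-- Finitely many trees have bounded height, so each finite partial sum is a truncated one.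
Truncation makes induction possible although the recursion for the full sums is nonlinear. -/
theorem tsum_weight_le {c : V → Option V → ℝ}
    (hc : ∀ i o, (∀ j, o = some j → G.Adj i j) → 0 < c i o)
    (hfix : ∀ i o, (∀ j, o = some j → G.Adj i j) →
      c i o = 1 - ∑ k ∈ nextNodes G i o, J i k ^ 2 * (c k (some i))⁻¹)
    (i : V) (o : Option V) (ho : ∀ j, o = some j → G.Adj i j) :
    ∑' T : BacktrackTree G i o, ENNReal.ofReal (T.weight J) ≤ ENNReal.ofReal (c i o)⁻¹ := by
  rw [ENNReal.tsum_eq_iSup_sum]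
  refine iSup_le fun s => ?_
  choose n hn using fun T : BacktrackTree G i o => T.exists_truncWeight_eq (J := J)
  calc ∑ T ∈ s, ENNReal.ofReal (T.weight J) = ∑ T ∈ s, T.truncWeight J (s.sup n) :=
        Finset.sum_congr rfl fun T hT => (hn T _ (Finset.le_sup hT)).symm
    _ ≤ ∑' T : BacktrackTree G i o, T.truncWeight J (s.sup n) := ENNReal.sum_le_tsum s
    _ ≤ _ := tsum_truncWeight_le hc hfix _ i o ho

theorem IsNormalizedModel.cavityOpt_pos (hJ : IsNormalizedModel G J) {z : V → ℝ}
    (hz0 : ∀ i, 0 < z i) (hz : ∀ i, ∑ k ∈ G.neighborFinset i, |J i k| * z k < z i)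
    (i : V) (o : Option V) (ho : ∀ j, o = some j → G.Adj i j) :
    0 < cavityOpt G (fixedJ G J) i o := by
  rcases o with _ | j
  · rw [← hJ.marginal_eq_cavityOpt]
    exact hJ.marginal_pos hz0 hz (hJ.fixedJ_lower_bound hz0 hz) i
  · rw [← hJ.cavity_eq_cavityOpt]
    exact hJ.cavity_fixedJ_pos hz0 hz (ho j rfl)

theorem IsNormalizedModel.tsum_weight_le_cavityOpt (hJ : IsNormalizedModel G J) {z : V → ℝ}
    (hz0 : ∀ i, 0 < z i) (hz : ∀ i, ∑ k ∈ G.neighborFinset i, |J i k| * z k < z i)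
    (i : V) (o : Option V) (ho : ∀ j, o = some j → G.Adj i j) :
    ∑' T : BacktrackTree G i o, ENNReal.ofReal (T.weight J)
      ≤ ENNReal.ofReal (cavityOpt G (fixedJ G J) i o)⁻¹ := by
  refine tsum_weight_le (hJ.cavityOpt_pos hz0 hz) (fun i o _ => ?_) i o ho
  rw [cavityOpt, sub_eq_add_neg, ← Finset.sum_neg_distrib]
  congr 1
  refine Finset.sum_congr rfl fun k hk => ?_
  rw [hJ.fixedJ_eq (fun i j hij => hJ.tendsto_messageJ hz0 hz hij)
    (fun i j hij => (hJ.cavity_fixedJ_pos hz0 hz hij).ne') (mem_nextNodes.1 hk).1.symm,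
    hJ.cavity_eq_cavityOpt, hJ.symm k i]

theorem IsNormalizedModel.summable_weight (hJ : IsNormalizedModel G J) {z : V → ℝ}
    (hz0 : ∀ i, 0 < z i) (hz : ∀ i, ∑ k ∈ G.neighborFinset i, |J i k| * z k < z i)
    (i : V) (o : Option V) (ho : ∀ j, o = some j → G.Adj i j) :
    Summable fun T : BacktrackTree G i o => T.weight J := by
  have h := ((hJ.tsum_weight_le_cavityOpt hz0 hz i o ho).trans_lt ENNReal.ofReal_lt_top).ne
  have := ENNReal.summable_toReal h
  simpa only [ENNReal.toReal_ofReal (BacktrackTree.weight_nonneg _)] using this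

theorem IsNormalizedModel.tsum_weight_eq (hJ : IsNormalizedModel G J) {z : V → ℝ}
    (hz0 : ∀ i, 0 < z i) (hz : ∀ i, ∑ k ∈ G.neighborFinset i, |J i k| * z k < z i)
    (i : V) (o : Option V) (ho : ∀ j, o = some j → G.Adj i j) :
    ∑' T : BacktrackTree G i o, T.weight J
      = 1 + (∑ k ∈ nextNodes G i o, J i k ^ 2 * ∑' A : BacktrackTree G k (some i), A.weight J) *
        ∑' T : BacktrackTree G i o, T.weight J := by
  have hk : ∀ k ∈ nextNodes G i o, Summable fun T : BacktrackTree G k (some i) => T.weight J :=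
    fun k hk => hJ.summable_weight hz0 hz k _ fun j hj => by
      cases hj; exact (mem_nextNodes.1 hk).1.symm
  have h := BacktrackTree.tsum_eq (G := G) (i := i) (o := o)
    (f := fun T => ENNReal.ofReal (T.weight J)) (by simp [BacktrackTree.weight])
    (fun k hik hk A B => BacktrackTree.ofReal_weight_cons k hik hk A B)
  have hs : ∀ k o, 0 ≤ ∑' T : BacktrackTree G k o, T.weight J :=
    fun k o => tsum_nonneg fun T => T.weight_nonneg
  have hk0 : ∀ k, 0 ≤ J i k ^ 2 * ∑' A : BacktrackTree G k (some i), A.weight J :=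
    fun k => mul_nonneg (sq_nonneg _) (hs _ _)
  rw [← ENNReal.ofReal_tsum_of_nonneg (fun T => T.weight_nonneg)
    (hJ.summable_weight hz0 hz i o ho)] at h
  rw [Finset.sum_congr rfl (g := fun k => ENNReal.ofReal
    (J i k ^ 2 * (∑' A : BacktrackTree G k (some i), A.weight J) *
      ∑' T : BacktrackTree G i o, T.weight J)) (fun k hk' => by
        rw [← ENNReal.ofReal_tsum_of_nonneg (fun T => T.weight_nonneg) (hk k hk'),
          ENNReal.ofReal_mul (hk0 k), ENNReal.ofReal_mul (sq_nonneg _)]),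
    ← ENNReal.ofReal_sum_of_nonneg (fun k _ => mul_nonneg (hk0 k) (hs _ _)), ← ENNReal.ofReal_one,
    ← ENNReal.ofReal_add zero_le_one (Finset.sum_nonneg fun k _ => mul_nonneg (hk0 k) (hs _ _)),
    ENNReal.ofReal_eq_ofReal_iff (hs _ _) (add_nonneg zero_le_one
      (Finset.sum_nonneg fun k _ => mul_nonneg (hk0 k) (hs _ _)))] at h
  rw [Finset.sum_mul]
  exact h

/-- This gives the converse of `tsum_weight_le_cavityOpt`. The tree sums solve the fixed-point
equations, and messages that start at zero cannot pass below such a solution. -/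
theorem IsNormalizedModel.neg_messageJ_le (hJ : IsNormalizedModel G J) {z : V → ℝ}
    (hz0 : ∀ i, 0 < z i) (hz : ∀ i, ∑ k ∈ G.neighborFinset i, |J i k| * z k < z i) (t : ℕ) :
    ∀ k i, G.Adj k i →
      -messageJ G J t k i ≤ J k i ^ 2 * ∑' A : BacktrackTree G k (some i), A.weight J := by
  have hs : ∀ k o, 0 ≤ ∑' T : BacktrackTree G k o, T.weight J :=
    fun k o => tsum_nonneg fun T => T.weight_nonneg
  induction t with
  | zero =>
    intro k i _
    simp only [messageJ, neg_zero]
    exact mul_nonneg (sq_nonneg _) (hs _ _)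
  | succ t ih =>
    intro k i hki
    rw [hJ.messageJ_succ, neg_neg]
    gcongr
    have hc := hJ.cavity_messageJ_pos hz0 hz t hki
    have heq := hJ.tsum_weight_eq hz0 hz k (some i) (fun j hj => by cases hj; exact hki)
    rw [inv_le_iff_one_le_mul₀ hc]
    have hsum : ∑ l ∈ nextNodes G k (some i), -messageJ G J t l k
        ≤ ∑ l ∈ nextNodes G k (some i),
          J k l ^ 2 * ∑' A : BacktrackTree G l (some k), A.weight J := by
      refine Finset.sum_le_sum fun l hl => ?_
      rw [hJ.symm k l]
      exact ih l k (mem_nextNodes.1 hl).1.symm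
    rw [hJ.cavity_eq_cavityOpt, cavityOpt]
    rw [Finset.sum_neg_distrib] at hsum
    nlinarith [mul_le_mul_of_nonneg_right hsum (hs k (some i))]

theorem IsNormalizedModel.hasSum_weight (hJ : IsNormalizedModel G J) {z : V → ℝ}
    (hz0 : ∀ i, 0 < z i) (hz : ∀ i, ∑ k ∈ G.neighborFinset i, |J i k| * z k < z i) (i : V) :
    HasSum (fun T : BacktrackTree G i none => T.weight J) (lbpVar G J i) := by
  have hs := hJ.summable_weight hz0 hz i none (by simp)
  have hc := hJ.cavityOpt_pos hz0 hz i none (by simp)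
  have hS : 0 ≤ ∑' T : BacktrackTree G i none, T.weight J :=
    tsum_nonneg fun T => T.weight_nonneg
  rw [lbpVar, hJ.marginal_eq_cavityOpt]
  convert hs.hasSum
  refine le_antisymm ?_ ?_
  · rw [inv_le_iff_one_le_mul₀ hc]
    have heq := hJ.tsum_weight_eq hz0 hz i none (by simp)
    have hsum : ∑ l ∈ nextNodes G i none, -fixedJ G J l i
        ≤ ∑ l ∈ nextNodes G i none,
          J i l ^ 2 * ∑' A : BacktrackTree G l (some i), A.weight J := by
      refine Finset.sum_le_sum fun l hl => ?_
      have hl := (mem_nextNodes.1 hl).1.symm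
      rw [hJ.symm i l]
      exact le_of_tendsto' (hJ.tendsto_messageJ hz0 hz hl).neg
        fun t => hJ.neg_messageJ_le hz0 hz t l i hl
    rw [Finset.sum_neg_distrib] at hsum
    rw [cavityOpt]
    nlinarith [mul_le_mul_of_nonneg_right hsum hS]
  · have h := hJ.tsum_weight_le_cavityOpt hz0 hz i none (by simp)
    rwa [← ENNReal.ofReal_tsum_of_nonneg (fun T => T.weight_nonneg) hs,
      ENNReal.ofReal_le_ofReal_iff (inv_nonneg.2 hc.le)] at h

/-- LBP captures the backtracking walks. -/
theorem IsNormalizedModel.hasSum_lbpWalks (hJ : IsNormalizedModel G J) {z : V → ℝ}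
    (hz0 : ∀ i, 0 < z i) (hz : ∀ i, ∑ k ∈ G.neighborFinset i, |J i k| * z k < z i) (i : V) :
    HasSum (fun w : lbpWalks G i => walkWeight (edgeWeight J) w.1) (lbpVar G J i) := by
  rw [← (treeEquivLbpWalks G i).hasSum_iff]
  convert hJ.hasSum_weight hz0 hz i using 2 with T
  exact T.walkWeight_toWalk hJ

end TreeSums

/-! ### Walk sums and their consequences for LBP. -/

section WalkSums

variable {V : Type*} [Fintype V] [DecidableEq V] {G : SimpleGraph V} [DecidableRel G.Adj]
  {J : Matrix V V ℝ}

variable (G) in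
/-- Decomposition of a walk at its first step. -/
def walkEquivSum (i j : V) :
    G.Walk i j ≃ PLift (i = j) ⊕ Σ k : {k // k ∈ G.neighborFinset i}, G.Walk k j where
  toFun
    | .nil => .inl ⟨rfl⟩
    | .cons (v := k) h w => .inr ⟨⟨k, (G.mem_neighborFinset _ _).2 h⟩, w⟩
  invFun
    | .inl h => SimpleGraph.Walk.nil.copy rfl h.down
    | .inr ⟨k, w⟩ => .cons ((G.mem_neighborFinset _ _).1 k.2) w
  left_inv w := by cases w <;> rfl
  right_inv x := by
    rcases x with ⟨⟨rfl⟩⟩ | ⟨k, w⟩ <;> rfl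

theorem walkEquivSum_symm_inl (i : V) (h : PLift (i = i)) :
    (walkEquivSum G i i).symm (.inl h) = .nil := rfl

theorem walkEquivSum_symm_inr {i j : V} (k : {k // k ∈ G.neighborFinset i}) (w : G.Walk k j) :
    (walkEquivSum G i j).symm (.inr ⟨k, w⟩) = .cons ((G.mem_neighborFinset _ _).1 k.2) w := rfl

theorem tsum_sum_sigma {α ι : Type*} {β : ι → Type*} [Fintype α] [Fintype ι]
    (f : α ⊕ (Σ k, β k) → ℝ) (hf : Summable f) :
    ∑' x, f x = ∑ a, f (.inl a) + ∑ k, ∑' b, f (.inr ⟨k, b⟩) := by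
  have hl : Summable fun x => f (.inl x) := hf.comp_injective Sum.inl_injective
  have hr : Summable fun x => f (.inr x) := hf.comp_injective Sum.inr_injective
  rw [Summable.tsum_sum hl hr, hr.tsum_sigma, tsum_fintype, tsum_fintype]

theorem tsum_walkWeight {R : Matrix V V ℝ}
    (hs : ∀ i j, Summable fun w : G.Walk i j => walkWeight R w) (i j : V) :
    ∑' w : G.Walk i j, walkWeight R w
      = (1 : Matrix V V ℝ) i j +
        ∑ k ∈ G.neighborFinset i, R i k * ∑' w : G.Walk k j, walkWeight R w := by
  have h : Summable fun x => walkWeight R ((walkEquivSum G i j).symm x) :=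
    (hs i j).comp_injective (walkEquivSum G i j).symm.injective
  rw [← (walkEquivSum G i j).symm.tsum_eq, tsum_sum_sigma _ h,
    ← Finset.sum_coe_sort (G.neighborFinset i)]
  congr 1
  · by_cases hij : i = j
    · subst hij
      rw [Fintype.sum_eq_single ⟨rfl⟩ (fun x hx => absurd rfl hx)]
      simp [walkEquivSum_symm_inl, walkWeight]
    · have : IsEmpty (PLift (i = j)) := ⟨fun h => hij h.down⟩
      simp [Matrix.one_apply_ne hij]
  · refine Finset.sum_congr rfl fun k _ => ?_
    rw [← tsum_mul_left]
    simp only [walkEquivSum_symm_inr, walkWeight_cons]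

theorem edgeWeight_of_mem_neighborFinset {i k : V}
    (h : k ∈ G.neighborFinset i) : edgeWeight J i k = -J i k :=
  edgeWeight_of_ne ((G.mem_neighborFinset _ _).1 h).ne

/-- Walk sums invert the information matrix. -/
theorem IsNormalizedModel.hasSum_walkWeight (hJ : IsNormalizedModel G J)
    (hW : WalkSummable G J) (i j : V) :
    HasSum (fun w : G.Walk i j => walkWeight (edgeWeight J) w) (J⁻¹ i j) := by
  have key : J * Matrix.of (fun i j => ∑' w : G.Walk i j, walkWeight (edgeWeight J) w) = 1 := by
    ext i j
    have h1 := tsum_walkWeight hW i j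
    have h2 := hJ.mulVec_apply (fun k => ∑' w : G.Walk k j, walkWeight (edgeWeight J) w) i
    rw [Finset.sum_congr rfl fun k hk => by rw [edgeWeight_of_mem_neighborFinset hk, neg_mul],
      Finset.sum_neg_distrib] at h1
    rw [Matrix.mul_apply]
    rw [Matrix.mulVec, dotProduct] at h2
    simp only [Matrix.of_apply]
    linarith
  rw [Matrix.inv_eq_right_inv key]
  exact (hW i j).hasSum

theorem walkWeight_abs (R : Matrix V V ℝ) {i j : V} (w : G.Walk i j) :
    walkWeight (R.map abs) w = |walkWeight R w| := by
  induction w with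
  | nil => simp [walkWeight_nil]
  | cons h w ih => rw [walkWeight_cons, walkWeight_cons, ih, abs_mul, Matrix.map_apply]

/-- Unconditional summability over the reals is absolute, so `(I - |R|)⁻¹` exists as a matrix of
walk sums. The vector `z` is its product with `u`, and the equation is the decomposition at the
first step. -/
theorem WalkSummable.exists_dominating (hW : WalkSummable G J) {u : V → ℝ} (hu : ∀ i, 0 < u i) :
    ∃ z : V → ℝ, (∀ i, 0 < z i) ∧ ∀ i, z i = u i + ∑ k ∈ G.neighborFinset i, |J i k| * z k := by
  have hs : ∀ i j, Summable fun w : G.Walk i j => walkWeight ((edgeWeight J).map abs) w := by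
    intro i j
    simpa only [walkWeight_abs] using (hW i j).abs
  have hz : ∀ i, ∑ j, (∑' w : G.Walk i j, walkWeight ((edgeWeight J).map abs) w) * u j
      = u i + ∑ k ∈ G.neighborFinset i, |J i k| *
        ∑ j, (∑' w : G.Walk k j, walkWeight ((edgeWeight J).map abs) w) * u j := by
    intro i
    simp only [Finset.mul_sum]
    rw [Finset.sum_comm, Finset.sum_congr rfl fun j _ => by rw [tsum_walkWeight hs i j, add_mul],
      Finset.sum_add_distrib]
    congr 1
    · simp [Matrix.one_apply]
    · refine Finset.sum_congr rfl fun j _ => ?_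
      rw [Finset.sum_mul]
      refine Finset.sum_congr rfl fun k hk => ?_
      rw [Matrix.map_apply, edgeWeight_of_mem_neighborFinset hk, abs_neg, mul_assoc]
  have h0 : ∀ i, 0 ≤ ∑ j, (∑' w : G.Walk i j, walkWeight ((edgeWeight J).map abs) w) * u j :=
    fun i => Finset.sum_nonneg fun j _ => mul_nonneg
      (tsum_nonneg fun w => by rw [walkWeight_abs]; exact abs_nonneg _) (hu j).le
  refine ⟨_, fun i => ?_, hz⟩
  rw [hz]
  exact add_pos_of_pos_of_nonneg (hu i)
    (Finset.sum_nonneg fun k _ => mul_nonneg (abs_nonneg _) (h0 k))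

theorem WalkSummable.exists_strictly_dominating (hW : WalkSummable G J) :
    ∃ z : V → ℝ, (∀ i, 0 < z i) ∧ ∀ i, ∑ k ∈ G.neighborFinset i, |J i k| * z k < z i := by
  obtain ⟨z, hz0, hz⟩ := hW.exists_dominating (u := fun _ => 1) fun _ => one_pos
  exact ⟨z, hz0, fun i => by linarith [hz i]⟩

theorem IsNormalizedModel.lbpConverges_of_walkSummable (hJ : IsNormalizedModel G J)
    (hW : WalkSummable G J) (h : V → ℝ) : LBPConverges G J h := by
  -- The summand `1` makes the dominance strict and `|h i|` makes room for the potentials.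
  obtain ⟨z, hz0, hz⟩ := hW.exists_dominating (u := fun i => 1 + |h i|)
    fun i => by positivity
  exact hJ.lbpConverges hz0 (fun i => by linarith [hz i, abs_nonneg (h i)])
    (fun i => by linarith [hz i])

theorem IsNormalizedModel.mulVec_lbpMean_of_walkSummable (hJ : IsNormalizedModel G J)
    (hW : WalkSummable G J) (h : V → ℝ) : J.mulVec (lbpMean G J h) = h := by
  obtain ⟨z, hz0, hz⟩ := hW.exists_strictly_dominating
  exact hJ.mulVec_lbpMean (hJ.lbpConverges_of_walkSummable hW h)
    fun i j hij => (hJ.cavity_fixedJ_pos hz0 hz hij).ne'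

theorem IsNormalizedModel.hasSum_lbpVar (hJ : IsNormalizedModel G J)
    (hW : WalkSummable G J) (i : V) :
    HasSum (fun w : lbpWalks G i => walkWeight (edgeWeight J) w.1) (lbpVar G J i) := by
  obtain ⟨z, hz0, hz⟩ := hW.exists_strictly_dominating
  exact hJ.hasSum_lbpWalks hz0 hz i

theorem IsNormalizedModel.mul_inv (hJ : IsNormalizedModel G J) : J * J⁻¹ = 1 :=
  Matrix.mul_nonsing_inv _ ((Matrix.isUnit_iff_isUnit_det _).1 hJ.posDef.isUnit)

/-! ### Attractive models are walk-summable. -/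

/-- The M-matrix argument: `x⁺` and `x⁻` have disjoint supports and off-diagonal entries are
nonpositive, so the quadratic form of `J` at `x⁻` is at most zero. Positive definiteness then
excludes `x⁻ ≠ 0`. -/
theorem nonneg_of_mulVec_nonneg (hJ : J.PosDef) (hoff : ∀ i j, i ≠ j → J i j ≤ 0) {x : V → ℝ}
    (hx : ∀ i, 0 ≤ J.mulVec x i) (i : V) : 0 ≤ x i := by
  by_contra! hi
  have hne : x⁻ ≠ 0 := fun h => by
    have := congrFun h i
    simp only [Pi.negPart_apply, Pi.zero_apply, negPart_eq_zero] at this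
    linarith
  have h1 := hJ.dotProduct_mulVec_pos hne
  simp only [star_trivial] at h1
  have h2 : J.mulVec x⁻ = J.mulVec x⁺ - J.mulVec x := by
    rw [← Matrix.mulVec_sub]
    congr 1
    linear_combination -posPart_sub_negPart x
  rw [h2, dotProduct_sub] at h1
  have h3 : 0 ≤ x⁻ ⬝ᵥ J.mulVec x :=
    Finset.sum_nonneg fun i _ => mul_nonneg (negPart_nonneg _) (hx i)
  have h4 : x⁻ ⬝ᵥ J.mulVec x⁺ ≤ 0 := by
    refine Finset.sum_nonpos fun i _ => ?_
    rw [Matrix.mulVec, dotProduct, Finset.mul_sum]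
    refine Finset.sum_nonpos fun j _ => ?_
    by_cases hij : i = j
    · subst hij
      rcases le_total 0 (x i) with h | h
      · simp [negPart_of_nonneg h]
      · simp [posPart_of_nonpos h]
    · exact mul_nonpos_of_nonneg_of_nonpos (negPart_nonneg _)
        (mul_nonpos_of_nonpos_of_nonneg (hoff i j hij) (posPart_nonneg _))
  linarith

theorem IsNormalizedModel.inv_nonneg_of_isAttractive (hJ : IsNormalizedModel G J)
    (hA : IsAttractive J) (i j : V) : 0 ≤ J⁻¹ i j := by
  refine nonneg_of_mulVec_nonneg hJ.posDef (x := fun i => J⁻¹ i j) (fun i j hij => ?_)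
    (fun i => ?_) i
  · have := hA i j
    rw [edgeWeight_of_ne hij] at this
    linarith
  · have : J.mulVec (fun i => J⁻¹ i j) i = (1 : Matrix V V ℝ) i j := by
      rw [← hJ.mul_inv]; rfl
    rw [this, Matrix.one_apply]
    positivity

theorem walkWeight_nonneg {R : Matrix V V ℝ} (hR : ∀ i j, 0 ≤ R i j) {i j : V}
    (w : G.Walk i j) : 0 ≤ walkWeight R w :=
  List.prod_nonneg fun x hx => by
    obtain ⟨d, _, rfl⟩ := List.mem_map.1 hx
    exact hR _ _

theorem tsum_walkWeight_length_lt (R : Matrix V V ℝ) (hR : ∀ i j, 0 ≤ R i j) (n : ℕ) (i j : V) :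
    ∑' w : G.Walk i j, (if w.length < n + 1 then ENNReal.ofReal (walkWeight R w) else 0)
      = ENNReal.ofReal ((1 : Matrix V V ℝ) i j) +
        ∑ k ∈ G.neighborFinset i, ENNReal.ofReal (R i k) *
          ∑' w : G.Walk k j, (if w.length < n then ENNReal.ofReal (walkWeight R w) else 0) := by
  rw [← (walkEquivSum G i j).symm.tsum_eq, Summable.tsum_sum ENNReal.summable ENNReal.summable,
    ENNReal.tsum_sigma', tsum_fintype, tsum_fintype, ← Finset.sum_coe_sort (G.neighborFinset i)]
  congr 1
  · by_cases hij : i = j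
    · subst hij
      rw [Fintype.sum_eq_single ⟨rfl⟩ (fun x hx => absurd rfl hx)]
      simp [walkEquivSum_symm_inl, walkWeight]
    · have : IsEmpty (PLift (i = j)) := ⟨fun h => hij h.down⟩
      simp [Matrix.one_apply_ne hij]
  · refine Finset.sum_congr rfl fun k _ => ?_
    rw [← ENNReal.tsum_mul_left]
    refine tsum_congr fun w => ?_
    simp [walkEquivSum_symm_inr, walkWeight_cons, ENNReal.ofReal_mul (hR i k)]

/-- Attractive models are walk-summable. -/
theorem IsNormalizedModel.walkSummable_of_isAttractive (hJ : IsNormalizedModel G J)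
    (hA : IsAttractive J) : WalkSummable G J := by
  have hP := hJ.inv_nonneg_of_isAttractive hA
  -- The nonnegative matrix `J⁻¹` satisfies the first-step recursion of the walk sums, hence
  -- dominates the sums over walks of bounded length.
  have key : ∀ n i j, ∑' w : G.Walk i j,
      (if w.length < n then ENNReal.ofReal (walkWeight (edgeWeight J) w) else 0)
        ≤ ENNReal.ofReal (J⁻¹ i j) := by
    intro n
    induction n with
    | zero => intro i j; simp
    | succ n ih =>
      intro i j
      have h2 := hJ.mulVec_apply (fun k => J⁻¹ k j) i
      have h1 : J.mulVec (fun i => J⁻¹ i j) i = (1 : Matrix V V ℝ) i j := by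
        rw [← hJ.mul_inv]; rfl
      have h3 : J⁻¹ i j = (1 : Matrix V V ℝ) i j +
          ∑ k ∈ G.neighborFinset i, edgeWeight J i k * J⁻¹ k j := by
        rw [Finset.sum_congr rfl fun k hk => by rw [edgeWeight_of_mem_neighborFinset hk, neg_mul],
          Finset.sum_neg_distrib]
        linarith
      have h4 : ∀ k, 0 ≤ edgeWeight J i k * J⁻¹ k j := fun k => mul_nonneg (hA i k) (hP k j)
      rw [tsum_walkWeight_length_lt _ hA, h3, ENNReal.ofReal_add
        (by rw [Matrix.one_apply]; positivity) (Finset.sum_nonneg fun k _ => h4 k),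
        ENNReal.ofReal_sum_of_nonneg fun k _ => h4 k]
      gcongr with k hk
      rw [ENNReal.ofReal_mul (hA i k)]
      gcongr
      exact ih k j
  intro i j
  have h0 := fun w : G.Walk i j => walkWeight_nonneg hA w
  have h : ∑' w : G.Walk i j, ENNReal.ofReal (walkWeight (edgeWeight J) w)
      ≤ ENNReal.ofReal (J⁻¹ i j) := by
    rw [ENNReal.tsum_eq_iSup_sum]
    refine iSup_le fun s => ?_
    refine le_trans (Finset.sum_le_sum fun w hw => ?_) ((ENNReal.sum_le_tsum s).trans
      (key (s.sup SimpleGraph.Walk.length + 1) i j))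
    rw [if_pos (Nat.lt_succ_of_le (Finset.le_sup hw))]
  have := ENNReal.summable_toReal (h.trans_lt ENNReal.ofReal_lt_top).ne
  simpa only [ENNReal.toReal_ofReal (h0 _)] using this

end WalkSums

/-! ### Closed walks in forests. -/

section Backtracking

variable {V W : Type*} {G : SimpleGraph V} {H : SimpleGraph W}

theorem WalkReduces.map (f : H →g G) {u v : W} {w w' : H.Walk u v} (h : WalkReduces w w') :
    WalkReduces (w.map f) (w'.map f) := by
  obtain ⟨p, hab, q⟩ := h
  rw [SimpleGraph.Walk.map_append, SimpleGraph.Walk.map_append]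
  exact .step _ (f.map_adj hab) _

theorem IsBacktracking.map (f : H →g G) {i : W} {w : H.Walk i i} (h : IsBacktracking w) :
    IsBacktracking (w.map f) :=
  Relation.ReflTransGen.lift (SimpleGraph.Walk.map f) (fun _ _ h => h.map f) _ _ h

theorem WalkReduces.length_lt {u v : V} {w w' : G.Walk u v} (h : WalkReduces w w') :
    w'.length < w.length := by
  obtain ⟨p, hab, q⟩ := h
  simp only [SimpleGraph.Walk.length_append, SimpleGraph.Walk.length_cons]
  omega

/-- Two equal consecutive edges form an immediate reversal `a, b, a`. -/
theorem exists_walkReduces_of_not_isChain {u v : V} (w : G.Walk u v)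
    (hw : ¬ List.IsChain (· ≠ ·) w.edges) : ∃ w', WalkReduces w w' := by
  induction w with
  | nil => simp at hw
  | @cons a b c h p ih =>
    cases p with
    | nil => simp at hw
    | @cons _ d _ h' q =>
      by_cases hd : d = a
      · subst hd
        exact ⟨q, .step .nil h q⟩
      · obtain ⟨p', hp'⟩ := ih fun hc => hw (by
          rw [SimpleGraph.Walk.edges_cons, SimpleGraph.Walk.edges_cons, List.isChain_cons_cons]
          refine ⟨fun he => ?_, by simpa using hc⟩
          rcases Sym2.eq_iff.1 he with ⟨rfl, _⟩ | ⟨rfl, _⟩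
          · exact h.ne rfl
          · exact hd rfl)
        exact ⟨.cons h p', hp'.append_left (.cons h .nil)⟩

/-- A closed walk in a forest is backtracking. -/
theorem isBacktracking_of_isAcyclic (hG : G.IsAcyclic) {i : V} (w : G.Walk i i) :
    IsBacktracking w := by
  induction hn : w.length using Nat.strong_induction_on generalizing w with
  | _ n ih =>
    by_cases hp : w.IsPath
    · rw [SimpleGraph.Walk.eq_nil_iff_nil.2 (SimpleGraph.Walk.isPath_iff_nil.1 hp)]
      exact .refl
    -- In a forest a walk without equal consecutive edges is a path, so a closed walk that is not a
    -- path can be shortened.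
    · rw [hG.isPath_iff_isChain] at hp
      obtain ⟨w', hw'⟩ := exists_walkReduces_of_not_isChain w hp
      exact .head hw' (ih _ (hn ▸ hw'.length_lt) w' rfl)

end Backtracking

/-! ### Restriction to the graph without the feedback nodes. -/

section Rest

variable {V : Type*} [Fintype V] [DecidableEq V] {G : SimpleGraph V} [DecidableRel G.Adj]
  {J : Matrix V V ℝ}

/-- The inclusion of the graph that remains after removal of `F`. -/
def restHom (G : SimpleGraph V) (F : Finset V) : restGraph G F →g G where
  toFun := Subtype.val
  map_rel' h := h

variable {F : Finset V}

/-- A walk of the remaining graph as a walk of the full graph. -/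
def restMap {i j : Rest F} (w : (restGraph G F).Walk i j) : G.Walk i.1 j.1 :=
  w.map (restHom G F)

theorem restMap_injective {i j : Rest F} :
    Function.Injective (restMap : (restGraph G F).Walk i j → G.Walk i.1 j.1) :=
  SimpleGraph.Walk.map_injective_of_injective (f := restHom G F) Subtype.val_injective i j

theorem support_restMap {i j : Rest F} (w : (restGraph G F).Walk i j) :
    (restMap w).support = w.support.map Subtype.val :=
  SimpleGraph.Walk.support_map (restHom G F) w

theorem restMap_cons {i j k : Rest F} (h : (restGraph G F).Adj i j) (w : (restGraph G F).Walk j k) :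
    restMap (.cons h w) = .cons (show G.Adj i.1 j.1 from h) (restMap w) := rfl

theorem restMap_nil {i : Rest F} :
    restMap (.nil : (restGraph G F).Walk i i) = .nil := rfl

theorem IsBacktracking.restMap {i : Rest F} {w : (restGraph G F).Walk i i}
    (h : IsBacktracking w) : IsBacktracking (restMap w) :=
  h.map (restHom G F)

theorem exists_restMap_eq {u v : V} (w : G.Walk u v) (hw : ∀ x ∈ w.support, x ∉ F)
    (hu : u ∉ F) (hv : v ∉ F) :
    ∃ w' : (restGraph G F).Walk ⟨u, hu⟩ ⟨v, hv⟩, restMap w' = w := by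
  induction w with
  | nil => exact ⟨.nil, rfl⟩
  | @cons a b c h w ih =>
    have hb : b ∉ F := hw b (by simp)
    obtain ⟨w', rfl⟩ := ih (fun x hx => hw x (by simp [hx])) hb hv
    have h' : (restGraph G F).Adj ⟨a, hu⟩ ⟨b, hb⟩ := h
    exact ⟨.cons h' w', rfl⟩

theorem notMem_of_mem_support_restMap {i j : Rest F} (w : (restGraph G F).Walk i j) :
    ∀ x ∈ (restMap w).support, x ∉ F := by
  intro x hx
  rw [support_restMap] at hx
  obtain ⟨y, _, rfl⟩ := List.mem_map.1 hx
  exact y.2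

theorem BacktrackTree.exists_rest {i : V} {o : Option V} (T : BacktrackTree G i o) :
    ∀ (i' : Rest F) (o' : Option (Rest F)), i'.1 = i → o'.map Subtype.val = o →
      (∀ x ∈ T.word, x ∉ F) →
      ∃ T' : BacktrackTree (restGraph G F) i' o', T'.word.map Subtype.val = T.word := by
  induction T with
  | nil i o => exact fun i' o' _ _ _ => ⟨nil _ _, rfl⟩
  | @cons i o k hik hk A B ihA ihB =>
    rintro i' o' rfl rfl hT
    simp only [word, List.mem_cons, List.mem_append] at hT
    have hkF : k ∉ F := hT k (.inl rfl)
    obtain ⟨A', hA⟩ := ihA ⟨k, hkF⟩ (some i') rfl rfl fun x hx => hT x (.inr (.inl hx))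
    obtain ⟨B', hB⟩ := ihB i' o' rfl rfl fun x hx => hT x (.inr (.inr (.inr hx)))
    refine ⟨cons ⟨k, hkF⟩ hik (fun h => hk (by rw [← h]; rfl)) A' B', ?_⟩
    simp [word, hA, hB]

/-- For the lifting direction, the tree of the embedded walk has only nodes outside `F` and
therefore lives in the remaining graph. -/
theorem isBacktracking_restMap {i : Rest F} {w : (restGraph G F).Walk i i} :
    IsBacktracking (restMap w) ↔ IsBacktracking w := by
  refine ⟨fun h => ?_, fun h => h.restMap⟩
  obtain ⟨T, hT⟩ := h.exists_tree
  have hs := congrArg SimpleGraph.Walk.support hT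
  rw [T.support_toWalk] at hs
  obtain ⟨T', hT'⟩ := T.exists_rest i none rfl rfl fun x hx =>
    notMem_of_mem_support_restMap w x (hs ▸ List.mem_cons_of_mem _ hx)
  have : T'.toWalk = w := by
    refine restMap_injective (SimpleGraph.Walk.ext_support ?_)
    rw [← hs, support_restMap, T'.support_toWalk, List.map_cons, ← hT']
  rw [← this]
  exact T'.isBacktracking_toWalk

theorem edgeWeight_restJ (i j : Rest F) : edgeWeight (restJ J F) i j = edgeWeight J i j := by
  by_cases h : i = j
  · subst h; simp [edgeWeight]
  · rw [edgeWeight_of_ne h, edgeWeight_of_ne fun h' => h (Subtype.ext h')]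
    rfl

theorem walkWeight_restMap {i j : Rest F} (w : (restGraph G F).Walk i j) :
    walkWeight (edgeWeight J) (restMap w) = walkWeight (edgeWeight (restJ J F)) w := by
  induction w with
  | nil => rw [restMap_nil, walkWeight_nil, walkWeight_nil]
  | cons h w ih => rw [restMap_cons, walkWeight_cons, walkWeight_cons, ih, edgeWeight_restJ]

theorem IsNormalizedModel.rest (hJ : IsNormalizedModel G J) (F : Finset V) :
    IsNormalizedModel (restGraph G F) (restJ J F) where
  posDef := hJ.posDef.submatrix Subtype.val_injective
  diag i := hJ.diag i
  markov i j hij h := hJ.markov i j (fun h' => hij (Subtype.ext h')) h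

theorem WalkSummable.rest (hW : WalkSummable G J) (F : Finset V) :
    WalkSummable (restGraph G F) (restJ J F) := fun i j => by
  have := (hW i j).comp_injective (restMap_injective (F := F) (i := i) (j := j))
  simpa only [Function.comp_def, walkWeight_restMap] using this

/-! ### Exactness of the feedback computations -/

theorem sum_eq_sum_feedback_add_sum_rest (F : Finset V) (f : V → ℝ) :
    ∑ k, f k = ∑ p : {p : V // p ∈ F}, f p + ∑ j : Rest F, f j := by
  rw [← Fintype.sum_subtype_add_sum_subtype (· ∈ F) f]
  congr!

theorem IsNormalizedModel.mulVec_gain (hJ : IsNormalizedModel G J) (hW : WalkSummable G J)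
    (F : Finset V) (p : {p : V // p ∈ F}) :
    (restJ J F).mulVec (gain G J F p) = fun i : Rest F => J i p :=
  (hJ.rest F).mulVec_lbpMean_of_walkSummable (hW.rest F) _

theorem IsNormalizedModel.mulVec_inv_col (hJ : IsNormalizedModel G J) (q i : V) :
    ∑ k, J i k * J⁻¹ k q = (1 : Matrix V V ℝ) i q := by
  rw [← hJ.mul_inv, Matrix.mul_apply]

/-- The rows of the covariance matrix outside `F` in terms of those in `F`. -/
theorem IsNormalizedModel.inv_rest_eq (hJ : IsNormalizedModel G J) (hW : WalkSummable G J)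
    (F : Finset V) (i : Rest F) (q : V) :
    J⁻¹ i q = (restJ J F)⁻¹.mulVec (fun j : Rest F => (1 : Matrix V V ℝ) j q) i
      - ∑ p : {p : V // p ∈ F}, gain G J F p i * J⁻¹ p q := by
  -- These are the rows outside `F` of `J * J⁻¹ = 1`, with the columns of `J` at the feedback nodes
  -- written as `restJ J F` times the gains.
  have h : (restJ J F).mulVec (fun j : Rest F =>
      J⁻¹ j q + ∑ p : {p : V // p ∈ F}, gain G J F p j * J⁻¹ p q)
      = fun i : Rest F => (1 : Matrix V V ℝ) i q := by
    funext i
    have h1 := hJ.mulVec_inv_col q i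
    rw [sum_eq_sum_feedback_add_sum_rest F] at h1
    rw [← h1, Matrix.mulVec, dotProduct]
    simp only [mul_add, Finset.sum_add_distrib, Finset.mul_sum]
    rw [Finset.sum_comm, add_comm]
    congr 1
    refine Finset.sum_congr rfl fun p _ => ?_
    have h2 := congrFun (hJ.mulVec_gain hW F p) i
    simp only [← h2, Matrix.mulVec, dotProduct, Finset.sum_mul, mul_assoc]
  rw [← h, Matrix.mulVec_mulVec, Matrix.nonsing_inv_mul _ ((Matrix.isUnit_iff_isUnit_det _).1
    (hJ.rest F).posDef.isUnit), Matrix.one_mulVec]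
  ring

theorem IsNormalizedModel.hatJ_apply (hJ : IsNormalizedModel G J) (F : Finset V)
    (p q : {p : V // p ∈ F}) : hatJ G J F p q = J p q - ∑ j : Rest F, J p j * gain G J F q j := by
  rw [hatJ]
  congr 1
  refine Finset.sum_congr rfl fun j _ => ?_
  split_ifs with h
  · rfl
  · rw [hJ.markov p j (fun h' => j.2 (h' ▸ p.2)) h, zero_mul]

theorem IsNormalizedModel.inv_feedback_rest_eq (hJ : IsNormalizedModel G J)
    (hW : WalkSummable G J) (F : Finset V) (i : Rest F) (q : {p : V // p ∈ F}) :
    J⁻¹ i q = - ∑ p : {p : V // p ∈ F}, gain G J F p i * J⁻¹ p q := by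
  have h0 : (fun i : Rest F => (1 : Matrix V V ℝ) i q) = 0 := by
    funext i
    exact Matrix.one_apply_ne fun h => i.2 (h ▸ q.2)
  rw [hJ.inv_rest_eq hW, h0, Matrix.mulVec_zero, Pi.zero_apply, zero_sub]

/-- With exact gains `hatJ` is the Schur complement of the block outside `F`, and a Schur complement
inverts the corresponding block of the inverse. -/
theorem IsNormalizedModel.hatJ_mul (hJ : IsNormalizedModel G J) (hW : WalkSummable G J)
    (F : Finset V) : hatJ G J F * J⁻¹.submatrix Subtype.val Subtype.val = 1 := by
  ext p q
  have h1 := hJ.mulVec_inv_col q p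
  rw [sum_eq_sum_feedback_add_sum_rest F] at h1
  simp only [hJ.inv_feedback_rest_eq hW F _ q] at h1
  have h2 : (1 : Matrix {p : V // p ∈ F} {p : V // p ∈ F} ℝ) p q = (1 : Matrix V V ℝ) p q := by
    by_cases h : p = q
    · rw [h, Matrix.one_apply_eq, Matrix.one_apply_eq]
    · rw [Matrix.one_apply_ne h, Matrix.one_apply_ne fun h' => h (Subtype.ext h')]
  rw [h2, ← h1, Matrix.mul_apply]
  simp only [hJ.hatJ_apply, Matrix.submatrix_apply, sub_mul, Finset.sum_sub_distrib,
    Finset.sum_mul, mul_neg, Finset.sum_neg_distrib, Finset.mul_sum, ← sub_eq_add_neg]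
  congr 1
  rw [Finset.sum_comm]
  simp only [mul_assoc]

theorem IsNormalizedModel.feedbackCov_eq (hJ : IsNormalizedModel G J) (hW : WalkSummable G J)
    (F : Finset V) : feedbackCov G J F = J⁻¹.submatrix Subtype.val Subtype.val :=
  Matrix.inv_eq_right_inv (hJ.hatJ_mul hW F)

theorem IsNormalizedModel.inv_symm (hJ : IsNormalizedModel G J) (i j : V) :
    J⁻¹ i j = J⁻¹ j i := by
  have := hJ.posDef.inv.isHermitian.apply j i
  simpa using this

/-- Walk-summability passes to the remaining graph and gives LBP convergence for every potential
vector, including the revised one. -/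
theorem IsNormalizedModel.fmpConverges (hJ : IsNormalizedModel G J) (hW : WalkSummable G J)
    (h : V → ℝ) (F : Finset V) : FMPConverges G J h F where
  first := (hJ.rest F).lbpConverges_of_walkSummable (hW.rest F) _
  gains _ _ := (hJ.rest F).lbpConverges_of_walkSummable (hW.rest F) _
  nonsingular := Matrix.isUnit_det_of_right_inverse (hJ.hatJ_mul hW F)
  second := (hJ.rest F).lbpConverges_of_walkSummable (hW.rest F) _

theorem IsNormalizedModel.fmpVar_of_mem (hJ : IsNormalizedModel G J) (hW : WalkSummable G J)
    {F : Finset V} {i : V} (hi : i ∈ F) : fmpVar G J F i = J⁻¹ i i := by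
  rw [fmpVar, dif_pos hi, hJ.feedbackCov_eq hW]
  rfl

/-- The correction by the feedback nodes is exactly `J⁻¹ i i - (restJ J F)⁻¹ i i`; only the partial
variance is approximate. -/
theorem IsNormalizedModel.fmpVar_of_notMem (hJ : IsNormalizedModel G J) (hW : WalkSummable G J)
    {F : Finset V} (i : Rest F) :
    fmpVar G J F i = J⁻¹ i i - (restJ J F)⁻¹ i i + lbpVar (restGraph G F) (restJ J F) i := by
  have h1 : (restJ J F)⁻¹.mulVec (fun j : Rest F => (1 : Matrix V V ℝ) j i) i = (restJ J F)⁻¹ i i := by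
    rw [Matrix.mulVec, dotProduct, Fintype.sum_eq_single i]
    · simp
    · intro j hj
      rw [Matrix.one_apply_ne fun h => hj (Subtype.ext h), mul_zero]
  rw [fmpVar, dif_neg i.2, hJ.feedbackCov_eq hW, hJ.inv_rest_eq hW F i i, h1]
  have h2 : ∀ p : {p : V // p ∈ F},
      J⁻¹ p i = -∑ q : {p : V // p ∈ F}, gain G J F q i * J⁻¹ p q := by
    intro p
    rw [hJ.inv_symm, hJ.inv_feedback_rest_eq hW]
    simp only [hJ.inv_symm p]
  have h3 : ∑ p : {p : V // p ∈ F}, gain G J F p i * J⁻¹ p i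
      = -∑ p : {p : V // p ∈ F}, ∑ q : {p : V // p ∈ F},
        gain G J F p i * J⁻¹ p q * gain G J F q i := by
    rw [← Finset.sum_neg_distrib]
    refine Finset.sum_congr rfl fun p _ => ?_
    rw [h2, mul_neg, Finset.mul_sum]
    congr 1
    exact Finset.sum_congr rfl fun q _ => by ring
  rw [h3]
  simp only [Matrix.submatrix_apply]
  ring

/-! ### Captured walks -/

theorem hasSum_subtype_iff_of_eq_univ {α : Type*} {S : Set α} (hS : S = Set.univ) {f : α → ℝ}
    {a : ℝ} : HasSum (fun x : S => f x.1) a ↔ HasSum f a := by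
  subst hS
  exact (Equiv.Set.univ α).hasSum_iff

/-- In the application `A` consists of the closed walks that avoid `F` and `C` of the backtracking
ones among them. -/
theorem hasSum_subtype_compl_union {α : Type*} {S A C : Set α} (hC : C ⊆ A) (hS : S = Aᶜ ∪ C)
    {f : α → ℝ} {a b c : ℝ} (ha : HasSum f a) (hb : HasSum (A.indicator f) b)
    (hc : HasSum (C.indicator f) c) : HasSum (fun x : S => f x.1) (a - b + c) := by
  refine (hasSum_subtype_iff_indicator (f := f)).2 ?_
  have h : S.indicator f = fun x => f x - A.indicator f x + C.indicator f x := ?_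
  · rw [h]
    exact (ha.sub hb).add hc
  rw [hS]
  funext x
  by_cases h1 : x ∈ A
  · by_cases h2 : x ∈ C <;> simp [Set.indicator, h1, h2]
  · have h2 : x ∉ C := fun h => h1 (hC h)
    simp [Set.indicator, h1, h2]

theorem lbpWalks_subset_fmpWalks (F : Finset V) (i : V) : lbpWalks G i ⊆ fmpWalks G F i := by
  intro w hw
  by_cases h : ∃ v ∈ w.support, v ∈ F
  · exact .inl h
  · exact .inr ⟨hw, fun v hv hvF => h ⟨v, hv, hvF⟩⟩

theorem fmpWalks_mono {A B : Finset V} (hAB : A ⊆ B) (i : V) : fmpWalks G A i ⊆ fmpWalks G B i := by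
  rintro w (⟨v, hv, hvA⟩ | ⟨hw, _⟩)
  · exact .inl ⟨v, hv, hAB hvA⟩
  · exact lbpWalks_subset_fmpWalks B i hw

theorem IsFVS.fmpWalks_eq_univ (hF : IsFVS G F) (i : V) : fmpWalks G F i = Set.univ := by
  refine Set.eq_univ_of_forall fun w => ?_
  by_cases h : ∃ v ∈ w.support, v ∈ F
  · exact .inl h
  · push Not at h
    have hi : i ∉ F := h i w.start_mem_support
    obtain ⟨w', rfl⟩ := exists_restMap_eq w h hi hi
    exact .inr ⟨(isBacktracking_of_isAcyclic hF w').restMap, h⟩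

theorem IsNormalizedModel.hasSum_fmpVar (hJ : IsNormalizedModel G J) (hW : WalkSummable G J)
    (F : Finset V) (i : V) :
    HasSum (fun w : fmpWalks G F i => walkWeight (edgeWeight J) w.1) (fmpVar G J F i) := by
  have hall := hJ.hasSum_walkWeight hW i i
  by_cases hi : i ∈ F
  · have : fmpWalks G F i = Set.univ :=
      Set.eq_univ_of_forall fun w => .inl ⟨i, w.start_mem_support, hi⟩
    rw [hJ.fmpVar_of_mem hW hi]
    exact (hasSum_subtype_iff_of_eq_univ this).2 hall
  · lift i to Rest F using hi
    set f : G.Walk i.1 i.1 → ℝ := fun w => walkWeight (edgeWeight J) w with hf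
    have hrest : HasSum ({w : G.Walk i.1 i.1 | ∀ x ∈ w.support, x ∉ F}.indicator f)
        ((restJ J F)⁻¹ i i) := by
      have := (hJ.rest F).hasSum_walkWeight (hW.rest F) i i
      rw [← (restMap_injective (G := G) (i := i) (j := i)).hasSum_iff]
      · convert this using 2 with w
        rw [Function.comp_apply, Set.indicator_of_mem]
        · exact walkWeight_restMap w
        · exact notMem_of_mem_support_restMap w
      · intro w hw
        refine Set.indicator_of_notMem (fun h => hw ?_) _
        exact exists_restMap_eq w h i.2 i.2
    have hback : HasSum
        ({w : G.Walk i.1 i.1 | IsBacktracking w ∧ ∀ x ∈ w.support, x ∉ F}.indicator f)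
        (lbpVar (restGraph G F) (restJ J F) i) := by
      have := (hJ.rest F).hasSum_lbpVar (hW.rest F) i
      have hinj : Function.Injective fun w : lbpWalks (restGraph G F) i => restMap w.1 :=
        restMap_injective.comp Subtype.val_injective
      rw [← hinj.hasSum_iff]
      · convert this using 2 with w
        rw [Function.comp_apply, Set.indicator_of_mem]
        · exact walkWeight_restMap w.1
        · exact ⟨isBacktracking_restMap.2 w.2, notMem_of_mem_support_restMap w.1⟩
      · intro w hw
        refine Set.indicator_of_notMem (fun h => hw ?_) _
        obtain ⟨w', hw'⟩ := exists_restMap_eq w h.2 i.2 i.2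
        exact ⟨⟨w', isBacktracking_restMap.1 (hw' ▸ h.1)⟩, hw'⟩
    rw [hJ.fmpVar_of_notMem hW]
    refine hasSum_subtype_compl_union (fun w hw => hw.2) ?_ hall hrest hback
    ext w
    simp [fmpWalks]

/-- All closed walks are captured, so uniqueness of sums gives exactness without a separate analysis
of belief propagation on forests. -/
theorem IsNormalizedModel.fmpVar_of_isFVS (hJ : IsNormalizedModel G J) (hW : WalkSummable G J)
    (hF : IsFVS G F) (i : V) : fmpVar G J F i = J⁻¹ i i := by
  have h := hJ.hasSum_fmpVar hW F i
  exact ((hasSum_subtype_iff_of_eq_univ (hF.fmpWalks_eq_univ i)).1 h).unique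
    (hJ.hasSum_walkWeight hW i i)

theorem hasSum_le_of_subset {R : Matrix V V ℝ} (hR : ∀ i j, 0 ≤ R i j) {i : V}
    {S T : Set (G.Walk i i)} (hST : S ⊆ T) {a b : ℝ}
    (ha : HasSum (fun w : S => walkWeight R w.1) a) (hb : HasSum (fun w : T => walkWeight R w.1) b) :
    a ≤ b :=
  hasSum_le_inj (Set.inclusion hST) (Set.inclusion_injective hST)
    (fun w _ => walkWeight_nonneg hR w.1) (fun _ => le_rfl) ha hb

end Rest

end GaussianFMP

theorem mainTheorem6 {V : Type*} [Fintype V] [DecidableEq V]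
    (G : SimpleGraph V) [DecidableRel G.Adj]
    (J : Matrix V V ℝ) (h : V → ℝ) (hJ : IsNormalizedModel G J)
    (F : Finset V) (hF : IsFVS G F)
    (k : ℕ) (Ft : Fin k → Finset V) (hmono : Monotone Ft) (hsub : ∀ j, Ft j ⊆ F) :
    -- attractive models: everything converges and the computed variances are monotone
    (IsAttractive J →
      LBPConverges G J h ∧ (∀ j, FMPConverges G J h (Ft j)) ∧ FMPConverges G J h F ∧
      ∀ i,
        lbpVar G J i ≤ fmpVar G J F i ∧
        (∀ j, lbpVar G J i ≤ fmpVar G J (Ft j) i) ∧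
        (∀ j₁ j₂, j₁ ≤ j₂ → fmpVar G J (Ft j₁) i ≤ fmpVar G J (Ft j₂) i) ∧
        (∀ j, fmpVar G J (Ft j) i ≤ fmpVar G J F i) ∧
        fmpVar G J F i = J⁻¹ i i) ∧
    -- walk-summable models: everything converges, each computed variance is the sum over the
    -- captured walks, and the sets of captured walks are nested
    (WalkSummable G J →
      LBPConverges G J h ∧ (∀ j, FMPConverges G J h (Ft j)) ∧ FMPConverges G J h F ∧
      ∀ i,
        (HasSum (fun w : lbpWalks G i => walkWeight (edgeWeight J) w.1) (lbpVar G J i) ∧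
          (∀ j, HasSum (fun w : fmpWalks G (Ft j) i => walkWeight (edgeWeight J) w.1)
            (fmpVar G J (Ft j) i)) ∧
          HasSum (fun w : fmpWalks G F i => walkWeight (edgeWeight J) w.1) (fmpVar G J F i)) ∧
        lbpWalks G i ⊆ fmpWalks G F i ∧
        (∀ j, lbpWalks G i ⊆ fmpWalks G (Ft j) i) ∧
        (∀ j₁ j₂, j₁ ≤ j₂ → fmpWalks G (Ft j₁) i ⊆ fmpWalks G (Ft j₂) i) ∧
        (∀ j, fmpWalks G (Ft j) i ⊆ fmpWalks G F i)) := by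
  constructor
  · intro hA
    have hW := hJ.walkSummable_of_isAttractive hA
    have hmonoVar : ∀ {A B : Finset V} (_ : A ⊆ B) (i : V), fmpVar G J A i ≤ fmpVar G J B i :=
      fun hAB i => hasSum_le_of_subset hA (fmpWalks_mono hAB i) (hJ.hasSum_fmpVar hW _ i)
        (hJ.hasSum_fmpVar hW _ i)
    have hlbp : ∀ (A : Finset V) (i : V), lbpVar G J i ≤ fmpVar G J A i :=
      fun A i => hasSum_le_of_subset hA (lbpWalks_subset_fmpWalks A i) (hJ.hasSum_lbpVar hW i)
        (hJ.hasSum_fmpVar hW A i)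
    exact ⟨hJ.lbpConverges_of_walkSummable hW h, fun j => hJ.fmpConverges hW h _,
      hJ.fmpConverges hW h F, fun i => ⟨hlbp F i, fun j => hlbp _ i,
        fun _ _ hj => hmonoVar (hmono hj) i, fun j => hmonoVar (hsub j) i,
        hJ.fmpVar_of_isFVS hW hF i⟩⟩
  · intro hW
    exact ⟨hJ.lbpConverges_of_walkSummable hW h, fun j => hJ.fmpConverges hW h _,
      hJ.fmpConverges hW h F, fun i => ⟨⟨hJ.hasSum_lbpVar hW i,
        fun j => hJ.hasSum_fmpVar hW _ i, hJ.hasSum_fmpVar hW F i⟩,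
        lbpWalks_subset_fmpWalks F i, fun j => lbpWalks_subset_fmpWalks _ i,
        fun _ _ hj => fmpWalks_mono (hmono hj) i, fun j => fmpWalks_mono (hsub j) i⟩⟩
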